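/- **Proposition (Power law properties of the variances and weights).** Consider feedforward neural networks with input dimension $d_{\mathrm{in}}\ge 1$, output dimension $d_{\mathrm{out}}\ge 1$ and $L$ hidden layers, one random network for each vector of hidden widths $\mathbf p=(p_1,\dots,p_L)$ with $p_l\ge 1$; put $p_0=d_{\mathrm{in}}$, $p_{L+1}=d_{\mathrm{out}}$. For $0\le l\le L$ the weight between node $j\in\{1,\dots,p_l\}$ of layer $l$ and node $m\in\{1,\dots,p_{l+1}\}$ of layer $l+1$ is $$W^{(l+1)}_{jm}=\sqrt{\lambda^{(l)}_{p_l,j}}\;V^{(l+1)}_{jm},$$ where $V^{(l+1)}_{jm}\sim\mathcal N(0,\sigma_v^2)$ for some $\sigma_v>0$, $\lambda^{(0)}_{p_0,j}=1/d_{\mathrm{in}}$, and, for $1\le l\le L$, $\lambda^{(l)}_{p_l,j}\sim\mu^{(l)}_{p_l}$ for probability distributions $\mu^{(l)}_{p}$ on $[0,\infty)$; in each network all the variables $\lambda^{(l)}_{p_l,j}$, $V^{(l+1)}_{jm}$ are independent. A Lévy measure on $(0,\infty)$ is a Borel measure $\rho$ with $\int_0^\infty\min(1,x)\,\rho(dx)<\infty$;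 its tail is $\overline\rho(x)=\rho((x,\infty))$, $x>0$. For $a\ge 0$, $\mathrm{ID}(a,\rho)$ denotes the infinitely divisible law on $[0,\infty)$ with Laplace transform $t\mapsto\exp\bigl(-ta-\int_0^\infty(1-e^{-tw})\rho(dw)\bigr)$, $t\ge0$. Fix $l\in\{1,\dots,L\}$ and suppose that, as $p_l\to\infty$, $$\sum_{j=1}^{p_l}\lambda^{(l)}_{p_l,j}\ \longrightarrow\ \mathrm{ID}(a^{(l)},\rho^{(l)})\quad\text{in distribution},$$ for some $a^{(l)}\ge 0$ and some Lévy measure $\rho^{(l)}$ on $(0,\infty)$. Let $\nu^{(l)}$ be the Lévy measure $$\nu^{(l)}(A)=\int_0^\infty \rho^{(l)}(\{w: wx\in A\})\,\frac{x^{-1/2}e^{-x/2}}{\sqrt{2\pi}}\,dx,$$ with tail $\overline\nu^{(l)}$. Let $\lambda^{(l)}_{p_l,(k)}$ be the $k$-th largest of $\lambda^{(l)}_{p_l,1},\dots,\lambda^{(l)}_{p_l,p_l}$, and let $|W^{(l+1)}|_{(k),m}$ be the $k$-th largest of $|W^{(l+1)}_{1m}|,\dots,|W^{(l+1)}_{p_lm}|$.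 Assume that for some $\tau>0$ and $c>0$, $\overline\rho^{(l)}(x)\sim c\,x^{-\tau}$ as $x\to\infty$. Then for all $k\ge1$ and every node $m$ of layer $l+1$ (which may be chosen depending on the network), as $p_l\to\infty$: 1. $\lambda^{(l)}_{p_l,(k)}$ converges in distribution to a probability law $Q_k$; for every $x>0$ with $\rho^{(l)}(\{x\})=0$, $\Pr(\lambda^{(l)}_{p_l,(k)}>x)\to Q_k((x,\infty))$; and, as $x\to\infty$, $$Q_k((x,\infty))\ \sim\ \frac{\overline\rho^{(l)}(x)^k}{k!}\ \sim\ \frac{c^k}{k!}\,x^{-k\tau}.$$ 2. $|W^{(l+1)}|_{(k),m}$ converges in distribution to a probability law $Q'_k$; for every $x>0$, $\Pr(|W^{(l+1)}|_{(k),m}>x)\to Q'_k((x,\infty))$; and, as $x\to\infty$, $$Q'_k((x,\infty))\ \sim\ \frac{\overline\nu^{(l)}(x^2/\sigma_v^2)^k}{k!}\ \sim\ \frac{1}{k!}\left(\frac{2^\tau\,\Gamma(\tau+1/2)}{\sqrt\pi}\,(\sigma_v^2)^\tau c\right)^{k}x^{-2k\tau}.$$ Here $f(x)\sim g(x)$ means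 $f(x)/g(x)\to1$. -/

import Mathlib

open MeasureTheory ProbabilityTheory Filter Set
open scoped NNReal ENNReal Topology

noncomputable section

/-- A Lévy measure on `(0, ∞)`: a Borel measure carried by `(0, ∞)` such that
`∫ min(1, x) ρ(dx) < ∞`. -/
structure IsLevyMeasure (ρ : Measure ℝ) : Prop where
  nonpos_null : ρ (Iic 0) = 0
  lintegral_min_lt_top : ∫⁻ x, ENNReal.ofReal (min 1 x) ∂ρ < ∞

/-- The tail Lévy measure `x ↦ ρ((x, ∞))`. -/
def levyTail (ρ : Measure ℝ) (x : ℝ) : ℝ := ρ.real (Ioi x)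

/-- `IsID a ρ Q`: the probability distribution `Q` on `[0, ∞)` is the infinitely divisible
distribution `ID(a, ρ)` with location parameter `a ≥ 0` and Lévy measure `ρ`, that is, its Laplace
transform is `t ↦ exp (- t a - ∫ (1 - e^{- t w}) ρ(dw))`. -/
structure IsID (a : ℝ) (ρ Q : Measure ℝ) : Prop where
  location_nonneg : 0 ≤ a
  levy : IsLevyMeasure ρ
  prob : IsProbabilityMeasure Q
  neg_null : Q (Iio 0) = 0
  laplace : ∀ t : ℝ, 0 ≤ t →
    ∫ x, Real.exp (-(t * x)) ∂Q = Real.exp (-(t * a) - ∫ w, (1 - Real.exp (-(t * w))) ∂ρ)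

/-- The measure `ν(dz) = ∫ ρ(dz / x) Gamma(x; 1/2, 1/2) dx`, where `ρ(dz / x)` gives mass
`ρ((u / x, v / x))` to the interval `(u, v)`: the image of `ρ ⊗ Gamma(1/2, 1/2)` under
multiplication. -/
def gammaMixture (ρ : Measure ℝ) : Measure ℝ :=
  (ρ.prod (gammaMeasure (1 / 2) (1 / 2))).map (fun q : ℝ × ℝ => q.1 * q.2)

/-- The `k`-th largest value `x_(k)` (for `1 ≤ k ≤ n`, counted with multiplicity) among
`x 0, …, x (n - 1)`. By convention it is `0` if `k = 0` or `k > n`. -/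
def kthLargest {n : ℕ} (x : Fin n → ℝ) (k : ℕ) : ℝ :=
  if h : 1 ≤ k ∧ k ≤ n then x (Tuple.sort x ⟨n - k, by omega⟩) else 0

/-- The numbers of nodes in the layers `0, 1, …, L, L + 1` of a feedforward network with input
dimension `din`, `L` hidden layers of widths `p`, and output dimension `dout`. -/
def layerWidth {L : ℕ} (din dout : ℕ+) (p : Fin L → ℕ+) : Fin (L + 2) → ℕ+ :=
  Fin.cons (α := fun _ => ℕ+) din (Fin.snoc (α := fun _ => ℕ+) p dout)

/-- Layer number `l + 1` of the network (the hidden layer with index `l : Fin L`) has `p l`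
nodes. -/
theorem layerWidth_hidden {L : ℕ} (din dout : ℕ+) (p : Fin L → ℕ+) (l : Fin L) :
    layerWidth din dout p l.succ.castSucc = p l := by
  rw [← Fin.succ_castSucc]
  simp [layerWidth]

/-- The random weights of a feedforward network with hidden widths `p`. For a layer `i`
(`0 ≤ i ≤ L`), `lam i j` is the variance parameter of node `j` of layer `i`, and `V i j k` is the
Gaussian variable attached to the edge from node `j` of layer `i` to node `k` of layer `i + 1`.
The input variances are `1 / din`; in a hidden layer of width `p` the variances have
law `μ l p`; the `V i j k` are `N(0, σ²)`; all these variables are independent. -/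
structure IsWeightModel {L : ℕ} (din dout : ℕ+) (μ : Fin L → ℕ+ → Measure ℝ) (σ : ℝ≥0)
    (p : Fin L → ℕ+) {Ω : Type*} [MeasurableSpace Ω] (P : Measure Ω)
    (lam : (i : Fin (L + 1)) → Fin (layerWidth din dout p i.castSucc) → Ω → ℝ)
    (V : (i : Fin (L + 1)) → Fin (layerWidth din dout p i.castSucc) →
      Fin (layerWidth din dout p i.succ) → Ω → ℝ) : Prop where
  lam_input : ∀ j, lam 0 j = fun _ => 1 / ((din : ℕ) : ℝ)
  lam_law : ∀ (l : Fin L) j, HasLaw (lam l.succ j) (μ l (p l)) P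
  V_law : ∀ i j k, HasLaw (V i j k) (gaussianReal 0 (σ ^ 2)) P
  indep : iIndepFun
    (Sum.elim
      (fun u : (i : Fin (L + 1)) × Fin (layerWidth din dout p i.castSucc) => lam u.1 u.2)
      (fun u : (i : Fin (L + 1)) × (Fin (layerWidth din dout p i.castSucc) ×
        Fin (layerWidth din dout p i.succ)) => V u.1 u.2.1 u.2.2)) P

/-- The weight `W = √lam · V` of the edge from node `j` of layer `i` to node `k` of layer
`i + 1`. -/
def weight {L : ℕ} {din dout : ℕ+} {p : Fin L → ℕ+} {Ω : Type*}
    (lam : (i : Fin (L + 1)) → Fin (layerWidth din dout p i.castSucc) → Ω → ℝ)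
    (V : (i : Fin (L + 1)) → Fin (layerWidth din dout p i.castSucc) →
      Fin (layerWidth din dout p i.succ) → Ω → ℝ)
    (i : Fin (L + 1)) (j : Fin (layerWidth din dout p i.castSucc))
    (k : Fin (layerWidth din dout p i.succ)) (ω : Ω) : ℝ :=
  √(lam i j ω) * V i j k ω

end

/-! Both order statistics are the `k`-th largest of `N = p_l` i.i.d. nonnegative variables with some
law `η`, so the number of exceedances of a level `x` is binomial with parameters `N` and `η((x,
∞))`. As soon as `N η((x, ∞))` converges to a tail `M((x, ∞))`, Poisson's limit theorem gives the
limit law: its tail at `x` is the probability that a Poisson variable of parameter `M((x, ∞))` is at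
least `k` (`exists_limit_law_kthLargest`). That probability is equivalent to `r ^ k / k!` as the
parameter `r` tends to `0` (`poissonTail_isEquivalent`), and `M((x, ∞)) → 0` as `x → ∞`. It remains
to identify `M`.

For the variances, `M = ρ`. The Laplace transform of an i.i.d. sum is an `N`-th power, so
convergence to `ID(a, ρ)` makes `N ∫ (1 - e^{-tw}) dη` converge to `t a + ∫ (1 - e^{-tw}) dρ`
(`tendsto_laplace_exponent`). In the variable `u = e^{-w}`, this is convergence of the moments of
the finite measures `N (1 - e^{-w}) η(dw)` on `[0, 1]`. Weierstrass approximation extends it to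
continuous functions of `u` (`tendsto_integral_comp_exp_neg`). The drift `a` becomes a mass at `u =
1`, that is `w = 0`, which tails at `x > 0` do not see; hence `tendsto_mul_measureReal_Ioi` at every
`x > 0` that is not an atom of `ρ`.

For the weights, given `V = v ≠ 0`, the event `|√λ v| > x` is `λ > x² / v²`. Dominated convergence
integrates the previous limit over `v` (`tendsto_mul_measureReal_absWeightLaw_Ioi`), and since `(V /
σ)²` has law `Gamma(1/2, 1/2)`, the result is the tail of `gammaMixture ρ` at `x² / σ²`. The power
law passes to this mixture as in Breiman's lemma, with the constant multiplied by the moment of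
order `τ` of `Gamma(1/2, 1/2)` (`tendsto_rpow_mul_levyTail_gammaMixture`). -/

/-! ### Poisson and binomial upper tails. -/

/-- The probability that a Poisson variable of parameter `r` is at least `k`. -/
noncomputable def poissonTail (k : ℕ) (r : ℝ) : ℝ :=
  1 - Real.exp (-r) * ∑ i ∈ Finset.range k, r ^ i / (i.factorial : ℝ)

/-- The probability that a binomial variable of parameters `n` and `q` is at least `k`. -/
noncomputable def binomialTail (k n : ℕ) (q : ℝ) : ℝ :=
  1 - ∑ i ∈ Finset.range k, (n.choose i : ℝ) * (q ^ i * (1 - q) ^ (n - i))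

theorem continuous_poissonTail (k : ℕ) : Continuous (poissonTail k) := by
  unfold poissonTail; fun_prop

theorem poissonTail_zero {k : ℕ} (hk : 1 ≤ k) : poissonTail k 0 = 0 := by
  obtain ⟨k, rfl⟩ := Nat.exists_eq_add_of_le' hk
  simp [poissonTail, Finset.sum_range_succ']

theorem poissonTail_le_one (k : ℕ) {r : ℝ} (hr : 0 ≤ r) : poissonTail k r ≤ 1 := by
  have : 0 ≤ Real.exp (-r) * ∑ i ∈ Finset.range k, r ^ i / (i.factorial : ℝ) := by positivity
  unfold poissonTail; linarith

/-- Differentiating the Poisson weights telescopes, leaving only the last one. Its nonnegativity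
gives the monotonicity in `r` that makes the limit a distribution function. -/
theorem hasDerivAt_poissonTail_succ (k : ℕ) (r : ℝ) :
    HasDerivAt (poissonTail (k + 1)) (Real.exp (-r) * (r ^ k / (k.factorial : ℝ))) r := by
  have he : HasDerivAt (fun r : ℝ => Real.exp (-r)) (-Real.exp (-r)) r := by
    simpa using (hasDerivAt_neg r).exp
  induction k with
  | zero =>
    have h : poissonTail (0 + 1) = fun r => 1 - Real.exp (-r) := by
      ext r; simp [poissonTail]
    rw [h]
    simpa using he.const_sub 1
  | succ k ih =>
    have h : poissonTail (k + 1 + 1) = fun r => poissonTail (k + 1) r -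
        Real.exp (-r) * (r ^ (k + 1) / ((k + 1).factorial : ℝ)) := by
      ext r; simp only [poissonTail, Finset.sum_range_succ _ (k + 1)]; ring
    rw [h]
    have h2 := he.mul ((hasDerivAt_pow (k + 1) r).div_const ((k + 1).factorial : ℝ))
    refine (ih.sub h2).congr_deriv ?_
    have : (k.factorial : ℝ) ≠ 0 := by positivity
    have : (k : ℝ) + 1 ≠ 0 := by positivity
    rw [Nat.factorial_succ]
    push_cast
    field_simp
    ring

theorem monotoneOn_poissonTail (k : ℕ) : MonotoneOn (poissonTail k) (Ici 0) := by
  cases k with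
  | zero => intro x _ y _ _; simp [poissonTail]
  | succ k =>
    refine monotoneOn_of_deriv_nonneg (convex_Ici 0) (continuous_poissonTail _).continuousOn
      (fun x _ => (hasDerivAt_poissonTail_succ k x).differentiableAt.differentiableWithinAt) ?_
    intro x hx
    rw [interior_Ici, mem_Ioi] at hx
    rw [(hasDerivAt_poissonTail_succ k x).deriv]
    positivity

/-- The Poisson tail is `e^{-r}` times the Taylor remainder of `exp` from order `k` on, and the
first term of the remainder dominates at `0`. -/
theorem poissonTail_isEquivalent (k : ℕ) :
    Asymptotics.IsEquivalent (𝓝 0) (poissonTail k) (fun r => r ^ k / (k.factorial : ℝ)) := by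
  have h1 : Asymptotics.IsEquivalent (𝓝 (0 : ℝ))
      (fun r => Real.exp r - ∑ i ∈ Finset.range k, r ^ i / (i.factorial : ℝ))
      (fun r => r ^ k / (k.factorial : ℝ)) := by
    have h := Real.exp_sub_sum_range_succ_isLittleO_pow k
    unfold Asymptotics.IsEquivalent
    have hk : (k.factorial : ℝ)⁻¹ ≠ 0 := by positivity
    have h' : (fun x : ℝ => Real.exp x - ∑ i ∈ Finset.range (k + 1), x ^ i / (i.factorial : ℝ))
        =o[𝓝 0] (fun r : ℝ => r ^ k / (k.factorial : ℝ)) := by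
      simp only [div_eq_inv_mul _ (k.factorial : ℝ)]
      exact h.trans_isBigO ((Asymptotics.isBigO_refl _ _).const_mul_right hk)
    refine h'.congr_left fun x => ?_
    simp only [Finset.sum_range_succ, Pi.sub_apply]; ring
  have h2 : Asymptotics.IsEquivalent (𝓝 (0 : ℝ)) 
      (fun r : ℝ => Real.exp (-r)) (Function.const ℝ (1 : ℝ)) := by
    rw [Asymptotics.isEquivalent_const_iff_tendsto one_ne_zero]
    have : Continuous fun r : ℝ => Real.exp (-r) := by fun_prop
    simpa using this.tendsto 0
  have h3 := h2.mul h1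
  refine (h3.congr_left ?_).congr_right ?_
  · refine Eventually.of_forall fun r => ?_
    simp only [poissonTail, Pi.mul_apply, mul_sub, ← Real.exp_add]
    simp
  · exact Eventually.of_forall fun r => by simp

theorem tendsto_zero_of_tendsto_natCast_mul {ι : Type*} {F : Filter ι} {N : ι → ℕ}
    (hN : Tendsto N F atTop) {q : ι → ℝ} {r : ℝ}
    (h : Tendsto (fun i => (N i : ℝ) * q i) F (𝓝 r)) : Tendsto q F (𝓝 0) := by
  have hN' : Tendsto (fun i => (N i : ℝ)) F atTop := tendsto_natCast_atTop_atTop.comp hN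
  have := h.mul (tendsto_inv_atTop_zero.comp hN')
  rw [mul_zero] at this
  refine this.congr' ?_
  filter_upwards [hN'.eventually_gt_atTop 0] with i hi
  simp only [Function.comp]; field_simp

/-- From `1 - 1/y ≤ log y ≤ y - 1` at `y = 1 - q`, the power lies between `exp(-N q / (1 - q))` and
`exp(-N q)`. -/
theorem tendsto_one_sub_pow {ι : Type*} {F : Filter ι} {N : ι → ℕ} (hN : Tendsto N F atTop)
    {q : ι → ℝ} {r : ℝ} (h : Tendsto (fun i => (N i : ℝ) * q i) F (𝓝 r)) :
    Tendsto (fun i => (1 - q i) ^ N i) F (𝓝 (Real.exp (-r))) := by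
  have hq : Tendsto q F (𝓝 0) := tendsto_zero_of_tendsto_natCast_mul hN h
  have hq1 : ∀ᶠ i in F, q i < 1 := hq.eventually_lt_const one_pos
  have hup : Tendsto (fun i => Real.exp (-((N i : ℝ) * q i))) F (𝓝 (Real.exp (-r))) :=
    (Real.continuous_exp.tendsto _).comp h.neg
  have hlo : Tendsto (fun i => Real.exp (-((N i : ℝ) * q i / (1 - q i)))) F
      (𝓝 (Real.exp (-r))) := by
    refine (Real.continuous_exp.tendsto _).comp (Tendsto.neg ?_)
    have := h.div (tendsto_const_nhds.sub hq) (by simp : (1 : ℝ) - 0 ≠ 0)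
    rwa [sub_zero, div_one] at this
  refine tendsto_of_tendsto_of_tendsto_of_le_of_le' hlo hup ?_ ?_
  · filter_upwards [hq1] with i hi
    have hp : 0 < 1 - q i := by linarith
    have e : -((N i : ℝ) * q i / (1 - q i)) = N i * (1 - (1 - q i)⁻¹) := by field_simp; ring
    rw [e, Real.exp_nat_mul]
    refine pow_le_pow_left₀ (Real.exp_pos _).le ?_ _
    rw [← Real.le_log_iff_exp_le hp]
    exact Real.one_sub_inv_le_log_of_pos hp
  · filter_upwards [hq1] with i hi
    rw [← mul_neg, Real.exp_nat_mul]
    refine pow_le_pow_left₀ (by linarith) ?_ _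
    exact Real.one_sub_le_exp_neg _

/-- Poisson limit theorem for the upper tails of binomial distributions. -/
theorem tendsto_binomialTail {ι : Type*} {F : Filter ι} {N : ι → ℕ} (hN : Tendsto N F atTop)
    {q : ι → ℝ} {r : ℝ} (h : Tendsto (fun i => (N i : ℝ) * q i) F (𝓝 r)) (k : ℕ) :
    Tendsto (fun i => binomialTail k (N i) (q i)) F (𝓝 (poissonTail k r)) := by
  have hq : Tendsto q F (𝓝 0) := tendsto_zero_of_tendsto_natCast_mul hN h
  have hq1 : ∀ᶠ i in F, q i < 1 := hq.eventually_lt_const one_pos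
  unfold binomialTail poissonTail
  rw [Finset.mul_sum]
  refine tendsto_const_nhds.sub (tendsto_finsetSum _ fun j _ => ?_)
  have h1 : Tendsto (fun i => ((N i).choose j : ℝ) * q i ^ j) F (𝓝 (r ^ j / j.factorial)) := by
    have he : Asymptotics.IsEquivalent F (fun i => ((N i).choose j : ℝ) * q i ^ j)
        (fun i => ((N i : ℝ) * q i) ^ j / j.factorial) := by
      refine (((isEquivalent_choose j).comp_tendsto hN).mul
        (Asymptotics.IsEquivalent.refl (u := fun i => q i ^ j))).congr_right ?_
      exact Eventually.of_forall fun i => by simp only [Pi.mul_apply, Function.comp]; ring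
    exact he.symm.tendsto_nhds ((h.pow j).div_const _)
  have h2 : Tendsto (fun i => (1 - q i) ^ (N i - j)) F (𝓝 (Real.exp (-r))) := by
    have h3 : Tendsto (fun i => (1 - q i) ^ N i * ((1 - q i) ^ j)⁻¹) F (𝓝 (Real.exp (-r))) := by
      have := (tendsto_one_sub_pow hN h).mul
        (((tendsto_const_nhds (x := (1 : ℝ))).sub hq).pow j |>.inv₀ (by simp))
      simpa using this
    refine h3.congr' ?_
    filter_upwards [hq1, hN.eventually_ge_atTop j] with i hi hj
    rw [pow_sub₀ _ (by linarith) hj]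
  rw [mul_comm]
  exact (h1.mul h2).congr fun i => by ring

/-! ### Order statistics as counts of exceedances. -/

/-- The sort is increasing and indexed from `0`, so position `n - k` is above `t` exactly when at
most `n - k` entries are `≤ t`. -/
theorem lt_kthLargest_iff {n k : ℕ} (hk : 1 ≤ k) (hkn : k ≤ n) (x : Fin n → ℝ) (t : ℝ) :
    t < kthLargest x k ↔ k ≤ (Finset.univ.filter fun j => t < x j).card := by
  have h1 := Tuple.lt_card_le_iff_apply_le_of_monotone (j := (⟨n - k, by omega⟩ : Fin n)) (a := t)
    (Tuple.monotone_sort x)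
  have h2 : (Finset.univ.filter fun i => (x ∘ Tuple.sort x) i ≤ t).card
      = (Finset.univ.filter fun i => x i ≤ t).card :=
    Finset.card_equiv (Tuple.sort x) (by simp)
  have h3 := Finset.card_filter_add_card_filter_not (s := (Finset.univ : Finset (Fin n)))
    (fun i => x i ≤ t)
  simp only [not_le, Finset.card_univ, Fintype.card_fin] at h3
  rw [h2] at h1
  rw [kthLargest, dif_pos ⟨hk, hkn⟩, ← not_le, ← Function.comp_apply (f := x), ← h1]
  simp only
  omega

theorem measurable_kthLargest {n : ℕ} (k : ℕ) :
    Measurable (fun x : Fin n → ℝ => kthLargest x k) := by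
  by_cases h : 1 ≤ k ∧ k ≤ n
  · refine measurable_of_Ioi fun t => ?_
    have hs : (fun x : Fin n → ℝ => kthLargest x k) ⁻¹' Ioi t =
        {x | (k : ℝ) ≤ ∑ j : Fin n, (Ioi t).indicator (fun _ => (1 : ℝ)) (x j)} := by
      ext x
      simp only [mem_preimage, mem_Ioi, mem_ofPred_eq, lt_kthLargest_iff h.1 h.2,
        Set.indicator_apply, Finset.sum_boole, Nat.cast_le]
    rw [hs]
    refine measurableSet_le measurable_const (Finset.measurable_sum _ fun j _ => ?_)
    exact (measurable_const.indicator measurableSet_Ioi).comp (measurable_pi_apply j)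
  · have : (fun x : Fin n → ℝ => kthLargest x k) = fun _ => 0 := by
      ext x; rw [kthLargest, dif_neg h]
    rw [this]; exact measurable_const

theorem measureReal_pi_lt_kthLargest {n k : ℕ} (hk : 1 ≤ k) (hkn : k ≤ n) (η : Measure ℝ)
    [IsProbabilityMeasure η] (t : ℝ) :
    (Measure.pi fun _ : Fin n => η).real {x | t < kthLargest x k} =
      binomialTail k n (η.real (Ioi t)) := by
  classical
  set q := η.real (Ioi t) with hq
  have hq' : η.real (Iic t) = 1 - q := by
    rw [hq, ← compl_Iic, probReal_compl_eq_one_sub measurableSet_Iic]; ring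
  -- Prescribing the exact set `S` of indices that exceed `t` gives a box, whose product measure
  -- depends only on the cardinality of `S`. The complement of the event is the disjoint union of
  -- these boxes over `S.card < k`.
  have hbox : ∀ S : Finset (Fin n),
      {x : Fin n → ℝ | (Finset.univ.filter fun j => t < x j) = S} =
        Set.pi univ fun j => if j ∈ S then Ioi t else Iic t := by
    intro S; ext x
    simp only [mem_ofPred_eq, Finset.ext_iff, Finset.mem_filter, Finset.mem_univ, true_and,
      Set.mem_pi, mem_univ, forall_const]
    refine forall_congr' fun j => ?_
    by_cases hj : j ∈ S <;> simp [hj]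
  have hmeas : ∀ S : Finset (Fin n), MeasurableSet
      {x : Fin n → ℝ | (Finset.univ.filter fun j => t < x j) = S} := by
    intro S; rw [hbox]
    refine MeasurableSet.univ_pi fun j => ?_
    split_ifs
    exacts [measurableSet_Ioi, measurableSet_Iic]
  have hS : ∀ S : Finset (Fin n), (Measure.pi fun _ : Fin n => η).real
      {x | (Finset.univ.filter fun j => t < x j) = S} = q ^ S.card * (1 - q) ^ (n - S.card) := by
    intro S
    rw [hbox, measureReal_def, Measure.pi_pi, ENNReal.toReal_prod]
    have : ∀ j, (η (if j ∈ S then Ioi t else Iic t)).toReal = if j ∈ S then q else 1 - q := by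
      intro j; split_ifs
      exacts [rfl, hq']
    simp only [this]
    rw [Finset.prod_ite, Finset.prod_const, Finset.prod_const]
    have e2 : (Finset.univ.filter fun j => j ∉ S) = Sᶜ := by ext; simp
    rw [e2, Finset.card_compl]
    simp
  have hcompl : {x : Fin n → ℝ | t < kthLargest x k}ᶜ =
      ⋃ S ∈ (Finset.univ : Finset (Fin n)).powerset.filter (fun S => S.card < k),
        {x | (Finset.univ.filter fun j => t < x j) = S} := by
    ext x
    simp only [mem_compl_iff, mem_ofPred_eq, lt_kthLargest_iff hk hkn, not_le, mem_iUnion,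
      Finset.mem_filter, Finset.mem_powerset, Finset.subset_univ, true_and, exists_prop]
    exact ⟨fun h => ⟨_, h, rfl⟩, by rintro ⟨S, h, rfl⟩; exact h⟩
  have hm : MeasurableSet {x : Fin n → ℝ | t < kthLargest x k} :=
    measurableSet_lt measurable_const (measurable_kthLargest k)
  have h1 := probReal_compl_eq_one_sub (μ := Measure.pi fun _ : Fin n => η) hm
  rw [hcompl, measureReal_biUnion_finset (fun S _ T _ hST => Set.disjoint_left.2
    fun x hx hy => hST (hx.symm.trans hy)) (fun S _ => hmeas S)] at h1
  simp only [hS] at h1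
  rw [Finset.sum_filter, Finset.sum_powerset_apply_card
    (fun i => if i < k then q ^ i * (1 - q) ^ (n - i) else 0)] at h1
  rw [binomialTail]
  have h2 : ∑ i ∈ Finset.range k, (n.choose i : ℝ) * (q ^ i * (1 - q) ^ (n - i)) =
      ∑ m ∈ Finset.range ((Finset.univ : Finset (Fin n)).card + 1),
        (Finset.univ : Finset (Fin n)).card.choose m •
          (if m < k then q ^ m * (1 - q) ^ (n - m) else 0) := by
    simp only [Finset.card_univ, Fintype.card_fin, nsmul_eq_mul, mul_ite, mul_zero]
    rw [← Finset.sum_filter]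
    refine Finset.sum_congr ?_ fun _ _ => rfl
    ext i; simp only [Finset.mem_range, Finset.mem_filter]; omega
  rw [h2]; linarith

/-- The `k`-th largest of `n` i.i.d. variables exceeds `t` with binomial probability. -/
theorem measureReal_lt_kthLargest {n k : ℕ} (hk : 1 ≤ k) (hkn : k ≤ n) {Ω : Type*}
    [MeasurableSpace Ω] {P : Measure Ω} {η : Measure ℝ} [IsProbabilityMeasure η]
    {Y : Fin n → Ω → ℝ} (hY : HasLaw (fun ω j => Y j ω) (Measure.pi fun _ => η) P) (t : ℝ) :
    P.real {ω | t < kthLargest (fun j => Y j ω) k} = binomialTail k n (η.real (Ioi t)) := by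
  rw [← measureReal_pi_lt_kthLargest hk hkn]
  exact hY.measureReal_eq (p := fun x => t < kthLargest x k)
    (measurableSet_lt measurable_const (measurable_kthLargest k))

/-! ### Tails of measures and the limit law of the order statistics. -/

theorem levyTail_nonneg (M : Measure ℝ) (x : ℝ) : 0 ≤ levyTail M x := measureReal_nonneg

theorem levyTail_anti {M : Measure ℝ} {x y : ℝ} (hM : M (Ioi x) ≠ ∞) (h : x ≤ y) :
    levyTail M y ≤ levyTail M x :=
  measureReal_mono (Ioi_subset_Ioi h) hM

theorem continuousWithinAt_levyTail {M : Measure ℝ} {x : ℝ} (hM : M (Ioi x) ≠ ∞) :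
    ContinuousWithinAt (levyTail M) (Ici x) x := by
  have h : Tendsto (fun y => M (Ioi y)) (𝓝[≥] x) (𝓝 (M (Ioi x))) := by
    refine tendsto_measure_of_ae_tendsto_indicator _ measurableSet_Ioi (fun _ => measurableSet_Ioi)
      (measurableSet_Ioi (a := x)) hM ?_ (Eventually.of_forall fun w => ?_)
    · filter_upwards [self_mem_nhdsWithin] with y hy using Ioi_subset_Ioi hy
    · rcases lt_or_ge x w with hw | hw
      · filter_upwards [nhdsWithin_le_nhds (Iio_mem_nhds hw)] with y hy
        exact ⟨fun _ => hw, fun _ => hy⟩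
      · filter_upwards [self_mem_nhdsWithin] with y hy
        exact ⟨fun h => absurd h (not_lt.2 (hw.trans hy)), fun h => absurd h (not_lt.2 hw)⟩
  exact (ENNReal.tendsto_toReal hM).comp h

theorem continuousWithinAt_levyTail_left {M : Measure ℝ} {x z : ℝ} (hz : z < x)
    (hM : M (Ioi z) ≠ ∞) (hx : M {x} = 0) :
    ContinuousWithinAt (levyTail M) (Iic x) x := by
  have h : Tendsto (fun y => M (Ioi y)) (𝓝[≤] x) (𝓝 (M (Ioi x))) := by
    refine tendsto_measure_of_ae_tendsto_indicator _ measurableSet_Ioi (fun _ => measurableSet_Ioi)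
      (measurableSet_Ioi (a := z)) hM ?_ ?_
    · filter_upwards [nhdsWithin_le_nhds (Ioi_mem_nhds hz)] with y hy using Ioi_subset_Ioi hy.le
    · have : ∀ᵐ w ∂M, w ≠ x := by rw [ae_iff]; simpa using hx
      filter_upwards [this] with w hwx
      rcases lt_or_gt_of_ne hwx with hw | hw
      · filter_upwards [nhdsWithin_le_nhds (Ioi_mem_nhds hw)] with y hy
        exact ⟨fun h => absurd h (not_lt.2 (mem_Ioi.1 hy).le),
          fun h => absurd h (not_lt.2 hw.le)⟩
      · filter_upwards [self_mem_nhdsWithin] with y hy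
        exact ⟨fun _ => hw, fun _ => lt_of_le_of_lt hy hw⟩
  exact (ENNReal.tendsto_toReal (measure_ne_top_of_subset (Ioi_subset_Ioi hz.le) hM)).comp h

theorem tendsto_levyTail_atTop {M : Measure ℝ} {z : ℝ} (hM : M (Ioi z) ≠ ∞) :
    Tendsto (levyTail M) atTop (𝓝 0) := by
  have h : Tendsto (fun y => M (Ioi y)) atTop (𝓝 (M ∅)) := by
    refine tendsto_measure_of_ae_tendsto_indicator _ MeasurableSet.empty
      (fun _ => measurableSet_Ioi) (measurableSet_Ioi (a := z)) hM ?_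
      (Eventually.of_forall fun w => ?_)
    · filter_upwards [eventually_ge_atTop z] with y hy using Ioi_subset_Ioi hy
    · filter_upwards [eventually_ge_atTop w] with y hy
      simpa using hy
  rw [measure_empty] at h
  exact (ENNReal.tendsto_toReal ENNReal.zero_ne_top).comp h

/-- The law on `[0, ∞)` of the `k`-th largest point of a Poisson process with intensity `M`. -/
theorem exists_measure_tail_eq_poissonTail {M : Measure ℝ} (hM : ∀ x, 0 < x → M (Ioi x) ≠ ∞)
    {k : ℕ} (hk : 1 ≤ k) :
    ∃ Q : Measure ℝ, IsProbabilityMeasure Q ∧ Q (Iio 0) = 0 ∧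
      ∀ x, 0 < x → Q.real (Ioi x) = poissonTail k (levyTail M x) := by
  -- `f` need not be right-continuous at `0`. The Stieltjes regularisation moves the jump there into
  -- an atom at `0`, which accounts for having fewer than `k` points in `(0, ∞)`.
  set f : ℝ → ℝ := fun x => if x ≤ 0 then 0 else 1 - poissonTail k (levyTail M x) with hf
  have hfm : Monotone f := by
    intro x y hxy
    simp only [hf]
    split_ifs with h1 h2 h2
    · exact le_rfl
    · exact sub_nonneg.2 (poissonTail_le_one k (levyTail_nonneg _ _))
    · exact absurd (hxy.trans h2) h1
    · refine sub_le_sub_left (monotoneOn_poissonTail k (levyTail_nonneg _ _) (levyTail_nonneg _ _)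
        (levyTail_anti (hM x (not_le.1 h1)) hxy)) _
  have hfneg : ∀ x < 0, hfm.stieltjesFunction x = 0 := by
    intro x hx
    rw [Monotone.stieltjesFunction_eq]
    have hc : ContinuousAt f x := by
      refine (continuousAt_const (y := (0 : ℝ))).congr ?_
      filter_upwards [Iio_mem_nhds hx] with y hy
      simp [hf, le_of_lt (mem_Iio.1 hy)]
    rw [hc.continuousWithinAt.rightLim_eq]
    simp [hf, hx.le]
  have hfpos : ∀ x, 0 < x → hfm.stieltjesFunction x = 1 - poissonTail k (levyTail M x) := by
    intro x hx
    rw [Monotone.stieltjesFunction_eq]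
    have hc : ContinuousWithinAt f (Ici x) x := by
      have h1 : ContinuousWithinAt (fun y => 1 - poissonTail k (levyTail M y)) (Ici x) x :=
        continuousWithinAt_const.sub
          ((continuous_poissonTail k).continuousAt.comp_continuousWithinAt
            (continuousWithinAt_levyTail (hM x hx)))
      refine h1.congr (fun y hy => ?_) ?_
      · simp [hf, not_le.2 (hx.trans_le (mem_Ici.1 hy))]
      · simp [hf, not_le.2 hx]
    rw [hc.rightLim_eq]
    simp [hf, not_le.2 hx]
  have hbot : Tendsto hfm.stieltjesFunction atBot (𝓝 0) := by
    refine tendsto_const_nhds.congr' ?_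
    filter_upwards [eventually_lt_atBot (0 : ℝ)] with x hx using (hfneg x hx).symm
  have htop : Tendsto hfm.stieltjesFunction atTop (𝓝 1) := by
    have h1 : Tendsto (fun x => 1 - poissonTail k (levyTail M x)) atTop (𝓝 1) := by
      have := ((continuous_poissonTail k).tendsto 0).comp
        (tendsto_levyTail_atTop (hM 1 one_pos))
      rw [poissonTail_zero hk] at this
      simpa using this.const_sub (1 : ℝ)
    refine h1.congr' ?_
    filter_upwards [eventually_gt_atTop (0 : ℝ)] with x hx using (hfpos x hx).symm
  refine ⟨hfm.stieltjesFunction.measure, StieltjesFunction.isProbabilityMeasure _ hbot htop,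
    ?_, fun x hx => ?_⟩
  · rw [StieltjesFunction.measure_Iio _ hbot]
    have : Function.leftLim hfm.stieltjesFunction 0 ≤ 0 := by
      refine le_of_tendsto (hfm.stieltjesFunction.mono.tendsto_leftLim 0) ?_
      filter_upwards [self_mem_nhdsWithin] with x hx using (hfneg x hx).le
    simpa using this
  · rw [measureReal_def, StieltjesFunction.measure_Ioi _ htop, hfpos x hx, sub_sub_cancel,
      ENNReal.toReal_ofReal]
    rw [← poissonTail_zero hk]
    exact monotoneOn_poissonTail k self_mem_Ici (levyTail_nonneg _ _) (levyTail_nonneg _ _)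

/-- Convergence of the tails on a dense set implies weak convergence. -/
theorem tendsto_probabilityMeasure_of_tendsto_tail {ι : Type*} {F : Filter ι}
    [F.IsCountablyGenerated] {Qs : ι → ProbabilityMeasure ℝ} {Q : ProbabilityMeasure ℝ}
    {D : Set ℝ} (hD : Dense D)
    (h : ∀ x ∈ D, Tendsto (fun i => (Qs i : Measure ℝ).real (Ioi x)) F
      (𝓝 ((Q : Measure ℝ).real (Ioi x)))) :
    Tendsto Qs F (𝓝 Q) := by
  refine IsPiSystem.tendsto_probabilityMeasure_of_tendsto_of_mem
    (S := {s | ∃ a ∈ D, ∃ b ∈ D, a < b ∧ s = Ioc a b}) ?_ ?_ ?_ ?_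
  · rintro _ ⟨a, ha, b, hb, -, rfl⟩ _ ⟨a', ha', b', hb', -, rfl⟩ hne
    rw [Ioc_inter_Ioc] at hne ⊢
    refine ⟨_, ?_, _, ?_, nonempty_Ioc.1 hne, rfl⟩
    · rcases max_choice a a' with e | e <;> simpa [e]
    · rcases min_choice b b' with e | e <;> simpa [e]
  · rintro _ ⟨a, ha, b, hb, -, rfl⟩
    exact measurableSet_Ioc
  · intro u hu x hx
    obtain ⟨a', b', hab, hsub⟩ := mem_nhds_iff_exists_Ioo_subset.1 (hu.mem_nhds hx)
    obtain ⟨a, ha, ha1, ha2⟩ := hD.exists_between hab.1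
    obtain ⟨b, hb, hb1, hb2⟩ := hD.exists_between hab.2
    exact ⟨_, ⟨a, ha, b, hb, ha2.trans hb1, rfl⟩, Ioc_mem_nhds ha2 hb1,
      fun y hy => hsub ⟨ha1.trans hy.1, hy.2.trans_lt hb2⟩⟩
  · rintro _ ⟨a, ha, b, hb, hab, rfl⟩
    have key : ∀ R : ProbabilityMeasure ℝ, ((R (Ioc a b) : ℝ≥0) : ℝ) =
        (R : Measure ℝ).real (Ioi a) - (R : Measure ℝ).real (Ioi b) := by
      intro R
      rw [← measureReal_sdiff (Ioi_subset_Ioi hab.le) measurableSet_Ioi, Ioi_sdiff_Ioi]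
      rfl
    rw [← NNReal.tendsto_coe]
    simp only [key]
    exact (h a ha).sub (h b hb)

/-- Limit law of the `k`-th largest of `N` i.i.d. variables with law `η` when `N η` converges
vaguely on `(0, ∞)`. -/
theorem exists_limit_law_kthLargest {ι : Type*} {F : Filter ι} [F.IsCountablyGenerated]
    {Ω : ι → Type*} [∀ i, MeasurableSpace (Ω i)] (P : ∀ i, Measure (Ω i))
    [∀ i, IsProbabilityMeasure (P i)] {N : ι → ℕ} (hN : Tendsto N F atTop)
    (η : ι → Measure ℝ) [∀ i, IsProbabilityMeasure (η i)] (hη : ∀ i, η i (Iio 0) = 0)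
    (Y : ∀ i, Fin (N i) → Ω i → ℝ)
    (hY : ∀ i, HasLaw (fun ω j => Y i j ω) (Measure.pi fun _ => η i) (P i))
    {M : Measure ℝ} (hM : ∀ x, 0 < x → M (Ioi x) ≠ ∞) {C : Set ℝ} (hC : C.Countable)
    (hconv : ∀ x, 0 < x → x ∉ C →
      Tendsto (fun i => (N i : ℝ) * (η i).real (Ioi x)) F (𝓝 (levyTail M x)))
    {k : ℕ} (hk : 1 ≤ k) :
    ∃ (Q : Measure ℝ) (_ : IsProbabilityMeasure Q),
      TendstoInDistribution (fun i ω => kthLargest (fun j => Y i j ω) k) F id P Q ∧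
      (∀ x, 0 < x → x ∉ C →
        Tendsto (fun i => (P i).real {ω | x < kthLargest (fun j => Y i j ω) k}) F
          (𝓝 (Q.real (Ioi x)))) ∧
      ∀ x, 0 < x → Q.real (Ioi x) = poissonTail k (levyTail M x) := by
  obtain ⟨Q, hQ, hQ0, hQt⟩ := exists_measure_tail_eq_poissonTail hM hk
  have hkN : ∀ᶠ i in F, k ≤ N i := hN.eventually_ge_atTop k
  have hpos : ∀ x, 0 < x → x ∉ C →
      Tendsto (fun i => (P i).real {ω | x < kthLargest (fun j => Y i j ω) k}) F
        (𝓝 (Q.real (Ioi x))) := by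
    intro x hx hxC
    rw [hQt x hx]
    refine (tendsto_binomialTail hN (hconv x hx hxC) k).congr' ?_
    filter_upwards [hkN] with i hi
    rw [measureReal_lt_kthLargest hk hi (hY i)]
  have hneg : ∀ x < 0, Tendsto (fun i => (P i).real {ω | x < kthLargest (fun j => Y i j ω) k}) F
        (𝓝 (Q.real (Ioi x))) := by
    intro x hx
    have hone : ∀ (R : Measure ℝ) [IsProbabilityMeasure R], R (Iio 0) = 0 → R.real (Ioi x) = 1 := by
      intro R _ hR
      rw [← compl_Iic, probReal_compl_eq_one_sub measurableSet_Iic, measureReal_def,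
        measure_mono_null (Iic_subset_Iio.2 hx) hR]
      simp
    rw [hone Q hQ0]
    refine tendsto_const_nhds.congr' ?_
    filter_upwards [hkN] with i hi
    rw [measureReal_lt_kthLargest hk hi (hY i), hone (η i) (hη i), binomialTail,
      Finset.sum_eq_zero, sub_zero]
    intro j hj
    -- Here the success probability is `1`, so each summand contains `0 ^ (N i - j)`; it vanishes
    -- because `j < k ≤ N i`.
    have : N i - j ≠ 0 := by have := Finset.mem_range.1 hj; omega
    simp [this]
  have hae : ∀ i, AEMeasurable (fun ω => kthLargest (fun j => Y i j ω) k) (P i) := fun i =>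
    (measurable_kthLargest k).comp_aemeasurable (hY i).aemeasurable
  refine ⟨Q, hQ, ⟨hae, aemeasurable_id, ?_⟩, hpos, hQt⟩
  -- The level `0` is discarded as well: `Q` may have an atom there, and nothing is assumed about
  -- `η((0, ∞))`.
  have hdense : Dense (insert 0 C)ᶜ := (hC.insert 0).dense_compl ℝ
  refine tendsto_probabilityMeasure_of_tendsto_tail hdense fun x hx => ?_
  rw [mem_compl_iff, mem_insert_iff, not_or] at hx
  simp only [ProbabilityMeasure.coe_mk, Measure.map_id]
  have hmap : ∀ i, ((P i).map (fun ω => kthLargest (fun j => Y i j ω) k)).real (Ioi x) =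
      (P i).real {ω | x < kthLargest (fun j => Y i j ω) k} := fun i =>
    map_measureReal_apply_of_aemeasurable (hae i) measurableSet_Ioi
  simp only [hmap]
  rcases lt_or_gt_of_ne hx.1 with h | h
  exacts [hneg x h, hpos x h hx.2]

/-! ### Lévy measures and the weight `1 - e^{-w}`. -/

theorem one_sub_exp_neg_nonneg {x : ℝ} (hx : 0 ≤ x) : 0 ≤ 1 - Real.exp (-x) := by
  rw [sub_nonneg]; exact Real.exp_le_one_iff.2 (by linarith)

theorem one_sub_exp_neg_pos {x : ℝ} (hx : 0 < x) : 0 < 1 - Real.exp (-x) := by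
  simpa using hx

theorem inv_one_sub_exp_neg_le {x : ℝ} (hx : 0 < x) : (1 - Real.exp (-x))⁻¹ ≤ 1 + x⁻¹ := by
  have h1 : Real.exp (-x) * (1 + x) ≤ 1 := by
    have := Real.add_one_le_exp x
    calc Real.exp (-x) * (1 + x) ≤ Real.exp (-x) * Real.exp x := by gcongr; linarith
      _ = 1 := by rw [← Real.exp_add]; simp
  have h2 : x / (1 + x) ≤ 1 - Real.exp (-x) := by
    rw [div_le_iff₀ (by positivity)]; nlinarith
  calc (1 - Real.exp (-x))⁻¹ ≤ (x / (1 + x))⁻¹ := inv_anti₀ (by positivity) h2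
    _ = 1 + x⁻¹ := by field_simp; ring

theorem one_sub_exp_neg_mul_le {t x : ℝ} (ht : 0 ≤ t) (hx : 0 ≤ x) :
    1 - Real.exp (-(t * x)) ≤ (1 + t) * min 1 x := by
  have h1 := Real.add_one_le_exp (-(t * x))
  have h2 := Real.exp_pos (-(t * x))
  rcases le_total 1 x with h | h
  · rw [min_eq_left h]; linarith
  · rw [min_eq_right h]; nlinarith

theorem measure_Ioi_lt_top_of_integrable {m : Measure ℝ}
    (hi : Integrable (fun w => 1 - Real.exp (-w)) m) {y : ℝ} (hy : 0 < y) : m (Ioi y) < ∞ := by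
  refine (measure_mono fun w hw => ?_).trans_lt (hi.measure_ge_lt_top (one_sub_exp_neg_pos hy))
  have : Real.exp (-w) ≤ Real.exp (-y) := Real.exp_le_exp.2 (neg_le_neg (le_of_lt hw))
  simp only [mem_ofPred_eq]; linarith

/-- Markov's inequality for `1 - e^{-w}`. The explicit growth `1 + y⁻¹` is what later supplies
integrable dominating functions. -/
theorem measureReal_Ioi_le_of_integrable {m : Measure ℝ} (h0 : ∀ᵐ w ∂m, 0 ≤ w)
    (hi : Integrable (fun w => 1 - Real.exp (-w)) m) {y : ℝ} (hy : 0 < y) :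
    m.real (Ioi y) ≤ (∫ w, (1 - Real.exp (-w)) ∂m) * (1 + y⁻¹) := by
  have hε := one_sub_exp_neg_pos hy
  have hnn : 0 ≤ᵐ[m] fun w => 1 - Real.exp (-w) := by
    filter_upwards [h0] with w hw using one_sub_exp_neg_nonneg hw
  have h1 := mul_meas_ge_le_integral_of_nonneg hnn hi (1 - Real.exp (-y))
  have h2 : m.real (Ioi y) ≤ m.real {w | 1 - Real.exp (-y) ≤ 1 - Real.exp (-w)} := by
    refine measureReal_mono (fun w hw => ?_) (hi.measure_ge_lt_top hε).ne
    have : Real.exp (-w) ≤ Real.exp (-y) := Real.exp_le_exp.2 (neg_le_neg (le_of_lt hw))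
    simp only [mem_ofPred_eq]; linarith
  calc m.real (Ioi y) ≤ (∫ w, (1 - Real.exp (-w)) ∂m) * (1 - Real.exp (-y))⁻¹ := by
        rw [← div_eq_mul_inv, le_div_iff₀ hε, mul_comm]
        exact (mul_le_mul_of_nonneg_left h2 hε.le).trans h1
    _ ≤ _ := mul_le_mul_of_nonneg_left (inv_one_sub_exp_neg_le hy) (integral_nonneg_of_ae hnn)

namespace IsLevyMeasure

variable {ρ : Measure ℝ}

theorem ae_pos (h : IsLevyMeasure ρ) : ∀ᵐ w ∂ρ, 0 < w := by
  rw [ae_iff]; convert h.nonpos_null using 2; ext; simp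

theorem integrable_min (h : IsLevyMeasure ρ) : Integrable (fun w => min 1 w) ρ := by
  refine ⟨by fun_prop, ?_⟩
  rw [hasFiniteIntegral_iff_ofReal]
  · exact h.lintegral_min_lt_top
  · filter_upwards [h.ae_pos] with w hw using (le_min zero_le_one hw.le)

theorem integrable_one_sub_exp_mul (h : IsLevyMeasure ρ) {t : ℝ} (ht : 0 ≤ t) :
    Integrable (fun w => 1 - Real.exp (-(t * w))) ρ := by
  refine (h.integrable_min.const_mul (1 + t)).mono' (by fun_prop) ?_
  filter_upwards [h.ae_pos] with w hw
  rw [Real.norm_of_nonneg (one_sub_exp_neg_nonneg (by positivity))]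
  exact one_sub_exp_neg_mul_le ht hw.le

theorem integrable_one_sub_exp (h : IsLevyMeasure ρ) :
    Integrable (fun w => 1 - Real.exp (-w)) ρ := by
  simpa using h.integrable_one_sub_exp_mul zero_le_one

theorem measure_Ioi_ne_top (h : IsLevyMeasure ρ) (x : ℝ) (hx : 0 < x) : ρ (Ioi x) ≠ ∞ :=
  (measure_Ioi_lt_top_of_integrable h.integrable_one_sub_exp hx).ne

theorem sigmaFinite (h : IsLevyMeasure ρ) : SigmaFinite ρ := by
  refine ⟨⟨⟨fun n : ℕ => Iic 0 ∪ Ioi (1 / ((n : ℝ) + 1)), fun _ => trivial, fun n => ?_, ?_⟩⟩⟩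
  · refine (measure_union_le _ _).trans_lt ?_
    rw [h.nonpos_null, zero_add]
    exact (h.measure_Ioi_ne_top _ (by positivity)).lt_top
  · rw [eq_univ_iff_forall]
    intro x
    rw [mem_iUnion]
    rcases le_or_gt x 0 with hx | hx
    · exact ⟨0, Or.inl hx⟩
    · obtain ⟨n, hn⟩ := exists_nat_one_div_lt hx
      exact ⟨n, Or.inr hn⟩

theorem countable_atoms (h : IsLevyMeasure ρ) : {x | ρ {x} ≠ 0}.Countable := by
  have := h.sigmaFinite
  have := Measure.countable_meas_pos_of_disjoint_iUnion (μ := ρ) (As := fun x : ℝ => {x})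
    (fun x => measurableSet_singleton x) (fun x y hxy => by simpa using hxy)
  simpa [pos_iff_ne_zero] using this

end IsLevyMeasure

/-! ### From Laplace exponents to vague convergence. -/

theorem integrable_comp_exp_neg_mul {m : Measure ℝ} (h0 : ∀ᵐ w ∂m, 0 ≤ w)
    (hi : Integrable (fun w => 1 - Real.exp (-w)) m) {f : ℝ → ℝ} (hf : Continuous f) :
    Integrable (fun w => f (Real.exp (-w)) * (1 - Real.exp (-w))) m := by
  obtain ⟨C, hC⟩ := isCompact_Icc.exists_bound_of_continuousOn
    (hf.continuousOn (s := Icc (0 : ℝ) 1))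
  refine hi.bdd_mul (c := C) (by fun_prop) ?_
  filter_upwards [h0] with w hw
  exact hC _ ⟨(Real.exp_pos _).le, Real.exp_le_one_iff.2 (by linarith)⟩

theorem abs_integral_comp_exp_neg_sub_le {m : Measure ℝ} (h0 : ∀ᵐ w ∂m, 0 ≤ w)
    (hi : Integrable (fun w => 1 - Real.exp (-w)) m) {f g : ℝ → ℝ} (hf : Continuous f)
    (hg : Continuous g) {ε : ℝ} (hfg : ∀ u ∈ Icc (0 : ℝ) 1, |f u - g u| ≤ ε) :
    |(∫ w, f (Real.exp (-w)) * (1 - Real.exp (-w)) ∂m) -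
      ∫ w, g (Real.exp (-w)) * (1 - Real.exp (-w)) ∂m| ≤
      ε * ∫ w, (1 - Real.exp (-w)) ∂m := by
  rw [← integral_sub (integrable_comp_exp_neg_mul h0 hi hf) (integrable_comp_exp_neg_mul h0 hi hg),
    ← integral_const_mul, ← Real.norm_eq_abs]
  refine norm_integral_le_of_norm_le (hi.const_mul ε) ?_
  filter_upwards [h0] with w hw
  rw [← sub_mul, norm_mul, Real.norm_of_nonneg (one_sub_exp_neg_nonneg hw)]
  exact mul_le_mul_of_nonneg_right
    (hfg _ ⟨(Real.exp_pos _).le, Real.exp_le_one_iff.2 (by linarith)⟩) (one_sub_exp_neg_nonneg hw)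

section LaplaceExponents

variable {ι : Type*} {F : Filter ι} {N : ι → ℕ} {η : ι → Measure ℝ} [∀ i, IsProbabilityMeasure (η i)]
  {a : ℝ} {ρ : Measure ℝ}

theorem integrable_one_sub_exp_of_prob {m : Measure ℝ} [IsProbabilityMeasure m]
    (h0 : ∀ᵐ w ∂m, 0 ≤ w) {t : ℝ} (ht : 0 ≤ t) :
    Integrable (fun w => 1 - Real.exp (-(t * w))) m := by
  refine (integrable_const (1 : ℝ)).mono' (by fun_prop) ?_
  filter_upwards [h0] with w hw
  rw [Real.norm_of_nonneg (one_sub_exp_neg_nonneg (by positivity))]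
  linarith [Real.exp_pos (-(t * w))]

/-- With `u = e^{-w}`, the function `u ^ n (1 - u)` is the difference of `1 - e^{-tw}` at `t = n +
1` and `t = n`. The corresponding drifts differ by `a`, which is the value at `u = 1` weighted by
`a`. -/
theorem tendsto_integral_polynomial_comp_exp_neg (hη : ∀ i, ∀ᵐ w ∂(η i), 0 ≤ w)
    (hρ : IsLevyMeasure ρ)
    (h : ∀ t, 0 ≤ t → Tendsto (fun i => (N i : ℝ) * ∫ w, (1 - Real.exp (-(t * w))) ∂(η i)) F
      (𝓝 (t * a + ∫ w, (1 - Real.exp (-(t * w))) ∂ρ))) (p : Polynomial ℝ) :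
    Tendsto (fun i => (N i : ℝ) *
        ∫ w, p.eval (Real.exp (-w)) * (1 - Real.exp (-w)) ∂(η i)) F
      (𝓝 (a * p.eval 1 + ∫ w, p.eval (Real.exp (-w)) * (1 - Real.exp (-w)) ∂ρ)) := by
  have hη0 : ∀ i, Integrable (fun w => 1 - Real.exp (-w)) (η i) := fun i => by
    simpa using integrable_one_sub_exp_of_prob (hη i) zero_le_one
  have hρ0 : ∀ᵐ w ∂ρ, 0 ≤ w := hρ.ae_pos.mono fun _ h => h.le
  induction p using Polynomial.induction_on' with
  | add p q hp hq =>
    have e : ∀ m : Measure ℝ, (∀ᵐ w ∂m, 0 ≤ w) → Integrable (fun w => 1 - Real.exp (-w)) m →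
        ∫ w, (p + q).eval (Real.exp (-w)) * (1 - Real.exp (-w)) ∂m =
        (∫ w, p.eval (Real.exp (-w)) * (1 - Real.exp (-w)) ∂m) +
          ∫ w, q.eval (Real.exp (-w)) * (1 - Real.exp (-w)) ∂m := by
      intro m h0 hi
      rw [← integral_add (integrable_comp_exp_neg_mul h0 hi p.continuous)
        (integrable_comp_exp_neg_mul h0 hi q.continuous)]
      simp only [Polynomial.eval_add, add_mul]
    rw [e ρ hρ0 hρ.integrable_one_sub_exp, Polynomial.eval_add]
    simp only [e _ (hη _) (hη0 _), mul_add]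
    convert hp.add hq using 2
    ring
  | monomial n c =>
    have e : ∀ m : Measure ℝ,
        (∀ t, 0 ≤ t → Integrable (fun w => 1 - Real.exp (-(t * w))) m) →
        ∫ w, (Polynomial.monomial n c).eval (Real.exp (-w)) * (1 - Real.exp (-w)) ∂m =
        c * ((∫ w, (1 - Real.exp (-(((n : ℝ) + 1) * w))) ∂m) -
          ∫ w, (1 - Real.exp (-((n : ℝ) * w))) ∂m) := by
      intro m hi
      rw [← integral_sub (hi _ (by positivity)) (hi _ (by positivity)), ← integral_const_mul]
      refine integral_congr_ae (Eventually.of_forall fun w => ?_)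
      have e1 : Real.exp (-(((n : ℝ) + 1) * w)) = Real.exp (-w) ^ n * Real.exp (-w) := by
        rw [← pow_succ, ← Real.exp_nat_mul]; push_cast; ring_nf
      have e2 : Real.exp (-((n : ℝ) * w)) = Real.exp (-w) ^ n := by
        rw [← Real.exp_nat_mul]; ring_nf
      simp only [Polynomial.eval_monomial, e1, e2]
      ring
    rw [e ρ fun t ht => hρ.integrable_one_sub_exp_mul ht]
    simp only [e _ fun t ht => integrable_one_sub_exp_of_prob (hη _) ht]
    have := ((h ((n : ℝ) + 1) (by positivity)).sub (h n (by positivity))).const_mul c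
    simp only [Polynomial.eval_monomial, one_pow, mul_one]
    convert this using 2 <;> ring

/-- Weierstrass approximation on `[0, 1]`: the total masses `N ∫ (1 - e^{-w}) dη` are eventually
bounded (the case `t = 1`), so a uniform error on `f` costs a uniformly small error on the
integrals. -/
theorem tendsto_integral_comp_exp_neg (hη : ∀ i, ∀ᵐ w ∂(η i), 0 ≤ w) (hρ : IsLevyMeasure ρ)
    (h : ∀ t, 0 ≤ t → Tendsto (fun i => (N i : ℝ) * ∫ w, (1 - Real.exp (-(t * w))) ∂(η i)) F
      (𝓝 (t * a + ∫ w, (1 - Real.exp (-(t * w))) ∂ρ))) {f : ℝ → ℝ} (hf : Continuous f) :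
    Tendsto (fun i => (N i : ℝ) * ∫ w, f (Real.exp (-w)) * (1 - Real.exp (-w)) ∂(η i)) F
      (𝓝 (a * f 1 + ∫ w, f (Real.exp (-w)) * (1 - Real.exp (-w)) ∂ρ)) := by
  have hη0 : ∀ i, Integrable (fun w => 1 - Real.exp (-w)) (η i) := fun i => by
    simpa using integrable_one_sub_exp_of_prob (hη i) zero_le_one
  have hρ0 : ∀ᵐ w ∂ρ, 0 ≤ w := hρ.ae_pos.mono fun _ h => h.le
  set K := ∫ w, (1 - Real.exp (-w)) ∂ρ with hK
  have hK0 : 0 ≤ K := integral_nonneg_of_ae <| by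
    filter_upwards [hρ0] with w hw using one_sub_exp_neg_nonneg hw
  have hbd : ∀ᶠ i in F, (N i : ℝ) * ∫ w, (1 - Real.exp (-w)) ∂(η i) < a + K + 1 := by
    have := h 1 zero_le_one
    simp only [one_mul] at this
    exact this.eventually_lt_const (by linarith)
  rw [Metric.tendsto_nhds]
  intro ε hε
  -- `B` bounds both the eventual masses before the limit, below `a + K + 1`, and the mass `|a| + K`
  -- in the limit, so each approximation error is at most `ε / 4`.
  set B := |a| + K + 1
  have hB : 0 < B := by positivity
  obtain ⟨p, hp⟩ := exists_polynomial_near_of_continuousOn 0 1 f hf.continuousOn (ε / (4 * B))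
    (by positivity)
  have hfp : ∀ u ∈ Icc (0 : ℝ) 1, |f u - p.eval u| ≤ ε / (4 * B) := fun u hu => by
    rw [abs_sub_comm]; exact (hp u hu).le
  have hδ : ε / (4 * B) * B = ε / 4 := by field_simp
  have hlim := tendsto_integral_polynomial_comp_exp_neg hη hρ h p
  rw [Metric.tendsto_nhds] at hlim
  filter_upwards [hbd, hlim (ε / 4) (by positivity)] with i hi1 hi2
  rw [Real.dist_eq] at hi2 ⊢
  have h1 := mul_le_mul_of_nonneg_left
    (abs_integral_comp_exp_neg_sub_le (hη i) (hη0 i) hf p.continuous hfp) (Nat.cast_nonneg (α := ℝ) (N i))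
  rw [← abs_of_nonneg (Nat.cast_nonneg (α := ℝ) (N i)), ← abs_mul, abs_of_nonneg
    (Nat.cast_nonneg (α := ℝ) (N i)), mul_sub] at h1
  have h1' : (N i : ℝ) * (ε / (4 * B) * ∫ w, (1 - Real.exp (-w)) ∂(η i)) ≤ ε / 4 := by
    rw [← hδ, mul_left_comm]
    refine mul_le_mul_of_nonneg_left (hi1.le.trans ?_) (by positivity)
    linarith [le_abs_self a]
  have h2 := abs_integral_comp_exp_neg_sub_le hρ0 hρ.integrable_one_sub_exp hf p.continuous hfp
  have h3 : |a * f 1 - a * p.eval 1| ≤ |a| * (ε / (4 * B)) := by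
    rw [← mul_sub, abs_mul]
    exact mul_le_mul_of_nonneg_left (hfp 1 (by simp)) (abs_nonneg _)
  have h4 : |a| * (ε / (4 * B)) + ε / (4 * B) * K ≤ ε / 4 := by
    rw [← hδ]
    have : 0 < ε / (4 * B) := by positivity
    simp only [B]
    nlinarith
  rw [abs_lt] at hi2 ⊢
  rw [abs_le] at h1 h2 h3
  constructor <;> linarith [h1.1, h1.2, h2.1, h2.2, h3.1, h3.2, hi2.1, hi2.2]

/-- A continuous function, equal to `0` on `(-∞, x]` and to `1` on `[y, ∞)`. -/
noncomputable def ramp (x y w : ℝ) : ℝ :=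
  max 0 (min 1 ((Real.exp (-x) - Real.exp (-w)) / (Real.exp (-x) - Real.exp (-y))))

theorem indicator_le_ramp {x y : ℝ} (hxy : x < y) (w : ℝ) :
    (Ioi y).indicator (fun _ => (1 : ℝ)) w ≤ ramp x y w := by
  by_cases hw : w ∈ Ioi y
  · rw [indicator_of_mem hw, ramp]
    refine le_max_of_le_right (le_min le_rfl ?_)
    have h1 : Real.exp (-y) < Real.exp (-x) := Real.exp_lt_exp.2 (by linarith)
    have h2 : Real.exp (-w) < Real.exp (-y) := Real.exp_lt_exp.2 (neg_lt_neg hw)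
    rw [le_div_iff₀ (by linarith)]; linarith
  · rw [indicator_of_notMem hw]; exact le_max_left _ _

theorem ramp_le_indicator {x y : ℝ} (hxy : x < y) (w : ℝ) :
    ramp x y w ≤ (Ioi x).indicator (fun _ => (1 : ℝ)) w := by
  by_cases hw : w ∈ Ioi x
  · rw [indicator_of_mem hw, ramp]
    exact max_le zero_le_one (min_le_left _ _)
  · rw [indicator_of_notMem hw, ramp]
    refine max_le le_rfl (min_le_of_right_le ?_)
    have h1 : Real.exp (-y) < Real.exp (-x) := Real.exp_lt_exp.2 (by linarith)
    have h2 : Real.exp (-x) ≤ Real.exp (-w) := Real.exp_le_exp.2 (neg_le_neg (not_lt.1 hw))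
    exact div_nonpos_of_nonpos_of_nonneg (by linarith) (by linarith)

theorem ramp_nonneg (x y w : ℝ) : 0 ≤ ramp x y w := le_max_left _ _

theorem integrable_ramp {m : Measure ℝ} {x y : ℝ} (hxy : x < y) (hm : m (Ioi x) ≠ ∞) :
    Integrable (ramp x y) m := by
  have hind : Integrable ((Ioi x).indicator (fun _ => (1 : ℝ))) m :=
    (integrable_indicator_iff measurableSet_Ioi).2 (integrableOn_const hm)
  refine hind.mono' (by unfold ramp; fun_prop) (Eventually.of_forall fun w => ?_)
  rw [Real.norm_of_nonneg (ramp_nonneg _ _ _)]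
  exact ramp_le_indicator hxy w

theorem measureReal_Ioi_le_integral_ramp {m : Measure ℝ} {x y : ℝ} (hxy : x < y)
    (hm : m (Ioi x) ≠ ∞) : m.real (Ioi y) ≤ ∫ w, ramp x y w ∂m := by
  rw [← integral_indicator_one measurableSet_Ioi]
  exact integral_mono_of_nonneg (Eventually.of_forall fun w =>
    indicator_nonneg (fun _ _ => zero_le_one) w) (integrable_ramp hxy hm)
    (Eventually.of_forall (indicator_le_ramp hxy))

theorem integral_ramp_le_measureReal_Ioi {m : Measure ℝ} {x y : ℝ} (hxy : x < y)
    (hm : m (Ioi x) ≠ ∞) : ∫ w, ramp x y w ∂m ≤ m.real (Ioi x) := by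
  rw [← integral_indicator_one measurableSet_Ioi]
  exact integral_mono_of_nonneg (Eventually.of_forall (ramp_nonneg x y))
    ((integrable_indicator_iff measurableSet_Ioi).2 (integrableOn_const hm))
    (Eventually.of_forall (ramp_le_indicator hxy))

theorem tendsto_integral_ramp (hη : ∀ i, ∀ᵐ w ∂(η i), 0 ≤ w) (hρ : IsLevyMeasure ρ)
    (h : ∀ t, 0 ≤ t → Tendsto (fun i => (N i : ℝ) * ∫ w, (1 - Real.exp (-(t * w))) ∂(η i)) F
      (𝓝 (t * a + ∫ w, (1 - Real.exp (-(t * w))) ∂ρ))) {x y : ℝ} (hx : 0 < x) (hxy : x < y) :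
    Tendsto (fun i => (N i : ℝ) * ∫ w, ramp x y w ∂(η i)) F (𝓝 (∫ w, ramp x y w ∂ρ)) := by
  have hlt : Real.exp (-y) < Real.exp (-x) := Real.exp_lt_exp.2 (by linarith)
  have hx1 := one_sub_exp_neg_pos hx
  -- The ramp divided by `1 - u`. Flooring the denominator at `1 - e^{-x}` keeps `f` continuous and
  -- changes nothing, since the numerator vanishes for `u ≥ e^{-x}`. In particular `f 1 = 0`, which
  -- removes the drift.
  set f : ℝ → ℝ := fun u => max 0 (min 1 ((Real.exp (-x) - u) / (Real.exp (-x) - Real.exp (-y)))) /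
    max (1 - u) (1 - Real.exp (-x)) with hfdef
  have hpos : ∀ u, 0 < max (1 - u) (1 - Real.exp (-x)) := fun u => lt_max_of_lt_right hx1
  have hf : Continuous f := by
    refine Continuous.div (by fun_prop) (by fun_prop) fun u => (hpos u).ne'
  have hmul : ∀ w, f (Real.exp (-w)) * (1 - Real.exp (-w)) = ramp x y w := by
    intro w
    rcases le_total (Real.exp (-w)) (Real.exp (-x)) with hw | hw
    · have e : max (1 - Real.exp (-w)) (1 - Real.exp (-x)) = 1 - Real.exp (-w) :=
        max_eq_left (by linarith)
      simp only [hfdef, ramp]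
      rw [e, div_mul_cancel₀]
      linarith
    · have e : ramp x y w = 0 := by
        rw [ramp, max_eq_left]
        exact min_le_of_right_le (div_nonpos_of_nonpos_of_nonneg (by linarith) (by linarith))
      rw [e]
      rw [ramp] at e
      simp only [hfdef, e, zero_div, zero_mul]
  have hf1 : f 1 = 0 := by
    have : max 0 (min 1 ((Real.exp (-x) - 1) / (Real.exp (-x) - Real.exp (-y)))) = 0 :=
      max_eq_left (min_le_of_right_le
        (div_nonpos_of_nonpos_of_nonneg (by linarith) (by linarith)))
    simp only [hfdef, this, zero_div]
  have := tendsto_integral_comp_exp_neg hη hρ h hf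
  simpa only [hmul, hf1, mul_zero, zero_add] using this

/-- Convergence of Laplace exponents implies vague convergence to the Lévy measure. -/
theorem tendsto_mul_measureReal_Ioi (hη : ∀ i, ∀ᵐ w ∂(η i), 0 ≤ w) (hρ : IsLevyMeasure ρ)
    (h : ∀ t, 0 ≤ t → Tendsto (fun i => (N i : ℝ) * ∫ w, (1 - Real.exp (-(t * w))) ∂(η i)) F
      (𝓝 (t * a + ∫ w, (1 - Real.exp (-(t * w))) ∂ρ))) {x : ℝ} (hx : 0 < x) (hx0 : ρ {x} = 0) :
    Tendsto (fun i => (N i : ℝ) * (η i).real (Ioi x)) F (𝓝 (levyTail ρ x)) := by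
  have hR := continuousWithinAt_levyTail (hρ.measure_Ioi_ne_top x hx)
  have hL := continuousWithinAt_levyTail_left (half_lt_self hx)
    (hρ.measure_Ioi_ne_top _ (half_pos hx)) hx0
  refine tendsto_order.2 ⟨fun c hc => ?_, fun c hc => ?_⟩
  -- The lower bound uses a ramp rising to the right of `x` and right-continuity of the tail. The
  -- upper bound uses a ramp to the left of `x`, where left-continuity requires that `x` not be an
  -- atom.
  · have h1 : ∀ᶠ y in 𝓝[>] x, c < levyTail ρ y :=
      (hR.mono Ioi_subset_Ici_self).eventually_const_lt hc
    obtain ⟨y, hy, hxy⟩ := (h1.and self_mem_nhdsWithin).exists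
    have hxy : x < y := hxy
    have h2 := tendsto_integral_ramp hη hρ h hx hxy
    filter_upwards [h2.eventually_const_lt (hy.trans_le (measureReal_Ioi_le_integral_ramp hxy
      (hρ.measure_Ioi_ne_top x hx)))] with i hi
    exact hi.trans_le (mul_le_mul_of_nonneg_left
      (integral_ramp_le_measureReal_Ioi hxy (measure_ne_top _ _)) (Nat.cast_nonneg _))
  · have h1 : ∀ᶠ y in 𝓝[<] x, levyTail ρ y < c :=
      (hL.mono Iio_subset_Iic_self).eventually_lt_const hc
    have h0 : ∀ᶠ y in 𝓝[<] x, 0 < y := nhdsWithin_le_nhds (Ioi_mem_nhds hx)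
    obtain ⟨y, ⟨hy, hy0⟩, hyx⟩ := ((h1.and h0).and self_mem_nhdsWithin).exists
    have hyx : y < x := hyx
    have h2 := tendsto_integral_ramp hη hρ h hy0 hyx
    filter_upwards [h2.eventually_lt_const ((integral_ramp_le_measureReal_Ioi hyx
      (hρ.measure_Ioi_ne_top y hy0)).trans_lt hy)] with i hi
    exact (mul_le_mul_of_nonneg_left
      (measureReal_Ioi_le_integral_ramp hyx (measure_ne_top _ _)) (Nat.cast_nonneg _)).trans_lt hi

theorem eventually_mul_measureReal_Ioi_le (hη : ∀ i, ∀ᵐ w ∂(η i), 0 ≤ w)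
    (h : ∀ t, 0 ≤ t → Tendsto (fun i => (N i : ℝ) * ∫ w, (1 - Real.exp (-(t * w))) ∂(η i)) F
      (𝓝 (t * a + ∫ w, (1 - Real.exp (-(t * w))) ∂ρ))) :
    ∃ B : ℝ, ∀ᶠ i in F, ∀ y, 0 < y → (N i : ℝ) * (η i).real (Ioi y) ≤ B * (1 + y⁻¹) := by
  have h1 := h 1 zero_le_one
  simp only [one_mul] at h1
  refine ⟨a + (∫ w, (1 - Real.exp (-w)) ∂ρ) + 1, ?_⟩
  filter_upwards [h1.eventually_lt_const (lt_add_one _)] with i hi y hy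
  have h2 := measureReal_Ioi_le_of_integrable (hη i)
    (by simpa using integrable_one_sub_exp_of_prob (hη i) zero_le_one) hy
  have h3 := mul_le_mul_of_nonneg_left h2 (Nat.cast_nonneg (α := ℝ) (N i))
  rw [← mul_assoc] at h3
  exact h3.trans (mul_le_mul_of_nonneg_right hi.le (by positivity))

end LaplaceExponents

/-! ### From convergence of the sums to Laplace exponents. -/

theorem ae_nonneg_of_measure_Iio {m : Measure ℝ} (h : m (Iio 0) = 0) : ∀ᵐ w ∂m, 0 ≤ w := by
  rw [ae_iff]; convert h using 2; ext; simp

/-- Truncation at `0` is almost surely invisible; it makes the exponential a bounded continuous test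
function on all of `ℝ` when `t ≥ 0`. -/
theorem integral_exp_neg_mul_sum {Ω : Type*} [MeasurableSpace Ω] {P : Measure Ω} {n : ℕ}
    {η : Measure ℝ} [IsProbabilityMeasure η] (hη : ∀ᵐ w ∂η, 0 ≤ w) {Y : Fin n → Ω → ℝ}
    (hY : HasLaw (fun ω j => Y j ω) (Measure.pi fun _ => η) P) (t : ℝ) :
    ∫ ω, Real.exp (-(t * max (∑ j, Y j ω) 0)) ∂P = (∫ w, Real.exp (-(t * w)) ∂η) ^ n := by
  have h1 := hY.integral_comp (f := fun x : Fin n → ℝ => Real.exp (-(t * max (∑ j, x j) 0)))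
    (by fun_prop)
  have h2 : ∫ x, Real.exp (-(t * max (∑ j, x j) 0)) ∂(Measure.pi fun _ : Fin n => η) =
      ∫ x, ∏ j, Real.exp (-(t * x j)) ∂(Measure.pi fun _ : Fin n => η) := by
    refine integral_congr_ae ?_
    have : ∀ᵐ x ∂(Measure.pi fun _ : Fin n => η), ∀ j, 0 ≤ x j := ae_all_iff.2 fun j =>
      (Measure.quasiMeasurePreserving_eval (fun _ : Fin n => η) j).ae hη
    filter_upwards [this] with x hx
    rw [max_eq_left (Finset.sum_nonneg fun j _ => hx j), ← Real.exp_sum, Finset.mul_sum,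
      Finset.sum_neg_distrib]
  rw [integral_fintype_prod_eq_pow (fun w => Real.exp (-(t * w))), Fintype.card_fin] at h2
  rw [← h2, ← h1]
  rfl

/-- Taking logarithms, `-N log φ → s`, so `φ → 1`; then `φ (-log φ) ≤ 1 - φ ≤ -log φ` squeezes. -/
theorem tendsto_mul_one_sub_of_tendsto_pow {ι : Type*} {F : Filter ι} {N : ι → ℕ}
    (hN : Tendsto N F atTop) {φ : ι → ℝ} (hφ : ∀ i, 0 < φ i) {s : ℝ}
    (h : Tendsto (fun i => φ i ^ N i) F (𝓝 (Real.exp (-s)))) :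
    Tendsto (fun i => (N i : ℝ) * (1 - φ i)) F (𝓝 s) := by
  have hlog : Tendsto (fun i => (N i : ℝ) * -Real.log (φ i)) F (𝓝 s) := by
    have := ((Real.continuousAt_log (Real.exp_pos (-s)).ne').tendsto.comp h).neg
    simp only [Real.log_exp, neg_neg] at this
    refine this.congr fun i => ?_
    simp [Real.log_pow]
  have hφ1 : Tendsto φ F (𝓝 1) := by
    have := (Real.continuous_exp.tendsto _).comp
      (tendsto_zero_of_tendsto_natCast_mul hN hlog).neg
    simp only [neg_zero, Real.exp_zero] at this
    refine this.congr fun i => ?_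
    simp [Real.exp_log (hφ i)]
  have hlow : Tendsto (fun i => φ i * ((N i : ℝ) * -Real.log (φ i))) F (𝓝 s) := by
    simpa using hφ1.mul hlog
  refine tendsto_of_tendsto_of_tendsto_of_le_of_le hlow hlog (fun i => ?_) fun i => ?_
  · have h1 := Real.one_sub_inv_le_log_of_pos (hφ i)
    have h2 := mul_le_mul_of_nonneg_left h1 (hφ i).le
    rw [mul_sub, mul_inv_cancel₀ (hφ i).ne'] at h2
    simp only
    rw [mul_left_comm]
    exact mul_le_mul_of_nonneg_left (by linarith) (Nat.cast_nonneg _)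
  · exact mul_le_mul_of_nonneg_left (by linarith [Real.log_le_sub_one_of_pos (hφ i)])
      (Nat.cast_nonneg _)

/-- Convergence of the sums to `ID(a, ρ)` gives convergence of the Laplace exponents. -/
theorem tendsto_laplace_exponent {ι : Type*} {F : Filter ι} {Ω : ι → Type*}
    [∀ i, MeasurableSpace (Ω i)] {P : ∀ i, Measure (Ω i)} [∀ i, IsProbabilityMeasure (P i)]
    {N : ι → ℕ} (hN : Tendsto N F atTop) {η : ι → Measure ℝ} [∀ i, IsProbabilityMeasure (η i)]
    (hη : ∀ i, ∀ᵐ w ∂(η i), 0 ≤ w) {Y : ∀ i, Fin (N i) → Ω i → ℝ}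
    (hY : ∀ i, HasLaw (fun ω j => Y i j ω) (Measure.pi fun _ => η i) (P i))
    {a : ℝ} {ρ Λ : Measure ℝ} [IsProbabilityMeasure Λ] (hΛ : IsID a ρ Λ)
    (hsum : TendstoInDistribution (fun i ω => ∑ j, Y i j ω) F id P Λ) {t : ℝ} (ht : 0 ≤ t) :
    Tendsto (fun i => (N i : ℝ) * ∫ w, (1 - Real.exp (-(t * w))) ∂(η i)) F
      (𝓝 (t * a + ∫ w, (1 - Real.exp (-(t * w))) ∂ρ)) := by
  have hint : ∀ i, Integrable (fun w => Real.exp (-(t * w))) (η i) := fun i => by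
    have := (integrable_const (1 : ℝ)).sub (integrable_one_sub_exp_of_prob (hη i) ht)
    refine this.congr (Eventually.of_forall fun w => ?_)
    simp
  have hpos : ∀ i, 0 < ∫ w, Real.exp (-(t * w)) ∂(η i) := fun i => integral_exp_pos (hint i)
  let g : BoundedContinuousFunction ℝ ℝ := BoundedContinuousFunction.ofNormedAddCommGroup
    (fun x => Real.exp (-(t * max x 0))) (by fun_prop) 1 fun x => by
      rw [Real.norm_of_nonneg (Real.exp_pos _).le, Real.exp_le_one_iff, neg_nonpos]
      positivity
  have hg := ProbabilityMeasure.tendsto_iff_forall_integral_tendsto.1 hsum.tendsto g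
  have h1 : ∀ i, ∫ x, g x ∂((P i).map fun ω => ∑ j, Y i j ω) =
      (∫ w, Real.exp (-(t * w)) ∂(η i)) ^ N i := fun i => by
    rw [integral_map (hsum.forall_aemeasurable i) g.continuous.aestronglyMeasurable]
    exact integral_exp_neg_mul_sum (hη i) (hY i) t
  have h2 : ∫ x, g x ∂Λ = Real.exp (-(t * a + ∫ w, (1 - Real.exp (-(t * w))) ∂ρ)) := by
    rw [neg_add', ← hΛ.laplace t ht]
    refine integral_congr_ae ?_
    filter_upwards [ae_nonneg_of_measure_Iio hΛ.neg_null] with x hx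
    change Real.exp (-(t * max x 0)) = _
    rw [max_eq_left hx]
  simp only [ProbabilityMeasure.coe_mk, Measure.map_id, h1, h2] at hg
  refine (tendsto_mul_one_sub_of_tendsto_pow hN hpos hg).congr fun i => ?_
  rw [integral_sub (integrable_const _) (hint i)]
  simp

/-! ### The law `Gamma(1/2, 1/2)` and squared Gaussians. -/

theorem integral_gammaMeasure {a r : ℝ} (f : ℝ → ℝ) (ha : 0 < a) (hr : 0 < r) :
    ∫ g, f g ∂(gammaMeasure a r) =
      ∫ g in Ioi 0, r ^ a / Real.Gamma a * g ^ (a - 1) * Real.exp (-(r * g)) * f g := by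
  rw [gammaMeasure, integral_withDensity_eq_integral_toReal_smul
    (f := gammaPDF a r) (by unfold gammaPDF; fun_prop) (by simp [gammaPDF]),
    ← integral_indicator measurableSet_Ioi]
  have h0 : ∀ᵐ g : ℝ, g ≠ 0 := by rw [ae_iff]; simp
  refine integral_congr_ae ?_
  filter_upwards [h0] with g hg
  rcases lt_or_gt_of_ne hg with h | h
  · rw [gammaPDF_of_neg h, indicator_of_notMem (by simpa using h.le)]; simp
  · rw [indicator_of_mem (by simpa using h), gammaPDF, ENNReal.toReal_ofReal
      (gammaPDFReal_nonneg ha hr _), gammaPDFReal, if_pos h.le, smul_eq_mul]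

theorem ae_pos_gammaMeasure {a r : ℝ} : ∀ᵐ g ∂(gammaMeasure a r), 0 < g := by
  have h0 : ∀ᵐ g : ℝ, g ≠ 0 := by rw [ae_iff]; simp
  rw [gammaMeasure, ae_withDensity_iff (by unfold gammaPDF; fun_prop)]
  filter_upwards [h0] with g hg hg2
  rcases lt_or_gt_of_ne hg with h | h
  · exact absurd (gammaPDF_of_neg h) hg2
  · exact h

theorem integral_rpow_gammaMeasure_half {s : ℝ} (hs : 0 ≤ s) :
    ∫ g, g ^ s ∂(gammaMeasure (1 / 2) (1 / 2)) =
      2 ^ s * Real.Gamma (s + 1 / 2) / √Real.pi := by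
  rw [integral_gammaMeasure _ (by norm_num) (by norm_num)]
  have h1 : ∀ g ∈ Ioi (0 : ℝ), (1 / 2 : ℝ) ^ (1 / 2 : ℝ) / Real.Gamma (1 / 2) *
      g ^ ((1 / 2 : ℝ) - 1) * Real.exp (-(1 / 2 * g)) * g ^ s =
      (1 / 2 : ℝ) ^ (1 / 2 : ℝ) / √Real.pi *
        (g ^ ((s + 1 / 2) - 1) * Real.exp (-(1 / 2 * g))) := by
    intro g hg
    rw [show s + 1 / 2 - 1 = (1 / 2 - 1) + s by ring, Real.rpow_add hg, Real.Gamma_one_half_eq]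
    ring
  rw [setIntegral_congr_fun measurableSet_Ioi h1, integral_const_mul,
    Real.integral_rpow_mul_exp_neg_mul_Ioi (by positivity) (by norm_num)]
  rw [one_div_one_div, Real.rpow_add two_pos, one_div, Real.inv_rpow zero_le_two]
  have : (2 : ℝ) ^ (2⁻¹ : ℝ) ≠ 0 := by positivity
  field_simp

theorem integrable_rpow_gammaMeasure_half {s : ℝ} (hs : 0 ≤ s) :
    Integrable (fun g => g ^ s) (gammaMeasure (1 / 2) (1 / 2)) := by
  by_contra h
  have h1 := integral_rpow_gammaMeasure_half hs
  -- A non-integrable function has Bochner integral `0`, contradicting the positive value of the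
  -- moment.
  rw [integral_undef h] at h1
  have : 0 < 2 ^ s * Real.Gamma (s + 1 / 2) / √Real.pi := by
    have := Real.Gamma_pos_of_pos (s := s + 1 / 2) (by positivity)
    positivity
  exact this.ne h1

/-- The square of a standard Gaussian variable has law `Gamma(1/2, 1/2)`. -/
theorem gaussianReal_map_sq :
    (gaussianReal 0 1).map (fun v => v ^ 2) = gammaMeasure (1 / 2) (1 / 2) := by
  have := isProbabilityMeasure_gammaMeasure (a := 1 / 2) (r := 1 / 2) (by norm_num) (by norm_num)
  have := Measure.isProbabilityMeasure_map (μ := gaussianReal 0 1)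
    (f := fun v => v ^ 2) (by fun_prop)
  refine ext_of_forall_integral_eq_of_IsFiniteMeasure fun f => ?_
  rw [integral_map (by fun_prop) f.continuous.aestronglyMeasurable,
    integral_gaussianReal_eq_integral_smul one_ne_zero,
    integral_gammaMeasure _ (by norm_num) (by norm_num)]
  have h1 : ∀ v : ℝ, gaussianPDFReal 0 1 v • f (v ^ 2) =
      (fun u => gaussianPDFReal 0 1 u • f (u ^ 2)) |v| := by
    intro v; simp [gaussianPDFReal]
  rw [integral_congr_ae (Eventually.of_forall h1)]
  -- Evenness folds the Gaussian integral onto the half-line, and `g = v ^ 2` turns the Gamma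
  -- integral into the same one.
  rw [integral_comp_abs (f := fun u => gaussianPDFReal 0 1 u • f (u ^ 2)), ← integral_comp_rpow_Ioi_of_pos (p := 2)
      (g := fun g : ℝ => (1 / 2 : ℝ) ^ (1 / 2 : ℝ) / Real.Gamma (1 / 2) *
        g ^ ((1 / 2 : ℝ) - 1) * Real.exp (-(1 / 2 * g)) * f g) (by norm_num),
    ← integral_const_mul]
  refine setIntegral_congr_fun measurableSet_Ioi fun v hv => ?_
  have hv : 0 < v := hv
  have e1 : (v ^ (2 : ℝ)) ^ ((1 / 2 : ℝ) - 1) = v⁻¹ := by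
    rw [← Real.rpow_mul hv.le, ← Real.rpow_neg_one]; norm_num
  have e2 : Real.exp (-(v - 0) ^ 2 / (2 * ((1 : ℝ≥0) : ℝ))) = Real.exp (-(1 / 2 * v ^ 2)) := by
    congr 1; simp only [NNReal.coe_one]; ring
  have e3 : (1 / 2 : ℝ) ^ (1 / 2 : ℝ) = (√2)⁻¹ := by
    rw [← Real.sqrt_eq_rpow, one_div, Real.sqrt_inv]
  have e4 : √(2 * Real.pi * ((1 : ℝ≥0) : ℝ)) = √2 * √Real.pi := by
    rw [NNReal.coe_one, mul_one, Real.sqrt_mul zero_le_two]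
  have e5 : v ^ ((2 : ℝ) - 1) = v := by norm_num
  simp only [gaussianPDFReal, smul_eq_mul, e1, e2, e3, e4, e5]
  rw [Real.rpow_two, Real.Gamma_one_half_eq]
  field_simp

/-! ### Tails of the law of the absolute weights. -/

theorem measurable_levyTail (m : Measure ℝ) : Measurable (levyTail m) := by
  have : Antitone fun y => m (Ioi y) := fun x y h => measure_mono (Ioi_subset_Ioi h)
  exact this.measurable.ennreal_toReal

theorem measureReal_prod_eq_integral_levyTail {m κ : Measure ℝ} [SFinite m] [SFinite κ]
    {S : Set (ℝ × ℝ)} (hS : MeasurableSet S) {φ : ℝ → ℝ}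
    (hφ : ∀ᵐ v ∂κ, (fun w => (w, v)) ⁻¹' S = Ioi (φ v)) (hfin : ∀ᵐ v ∂κ, m (Ioi (φ v)) < ∞) :
    (m.prod κ).real S = ∫ v, levyTail m (φ v) ∂κ := by
  rw [measureReal_def, Measure.prod_apply_symm hS,
    ← integral_toReal (measurable_measure_prodMk_right hS).aemeasurable]
  · refine integral_congr_ae ?_
    filter_upwards [hφ] with v hv
    rw [hv]; rfl
  · filter_upwards [hφ, hfin] with v hv hv'
    rwa [hv]

theorem measure_prod_lt_top_of_integrable_levyTail {m κ : Measure ℝ} [SFinite m] [SFinite κ]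
    {S : Set (ℝ × ℝ)} (hS : MeasurableSet S) {φ : ℝ → ℝ}
    (hφ : ∀ᵐ v ∂κ, (fun w => (w, v)) ⁻¹' S = Ioi (φ v)) (hfin : ∀ᵐ v ∂κ, m (Ioi (φ v)) < ∞)
    (hint : Integrable (fun v => levyTail m (φ v)) κ) : (m.prod κ) S < ∞ := by
  have h := hint.2
  rw [hasFiniteIntegral_iff_ofReal (Eventually.of_forall fun v => levyTail_nonneg _ _)] at h
  rw [Measure.prod_apply_symm hS]
  refine (lintegral_congr_ae ?_).trans_lt h
  filter_upwards [hφ, hfin] with v hv hv'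
  rw [hv, levyTail, measureReal_def, ENNReal.ofReal_toReal hv'.ne]

theorem lt_abs_sqrt_mul_iff {x v : ℝ} (hx : 0 < x) (hv : v ≠ 0) (w : ℝ) :
    x < |√w * v| ↔ x ^ 2 / v ^ 2 < w := by
  have hv' : 0 < |v| := abs_pos.2 hv
  rw [abs_mul, abs_of_nonneg (Real.sqrt_nonneg w), ← div_lt_iff₀ hv', Real.lt_sqrt (by positivity),
    div_pow, sq_abs]

/-- The law of `|√λ v|` for independent `λ` with law `m` and `v` with law `N(0, σ²)`. -/
noncomputable def absWeightLaw (σ : ℝ≥0) (m : Measure ℝ) : Measure ℝ :=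
  (m.prod (gaussianReal 0 (σ ^ 2))).map fun q => |√q.1 * q.2|

theorem isProbabilityMeasure_absWeightLaw (σ : ℝ≥0) (m : Measure ℝ) [IsProbabilityMeasure m] :
    IsProbabilityMeasure (absWeightLaw σ m) :=
  Measure.isProbabilityMeasure_map (by fun_prop)

theorem absWeightLaw_Iio_zero (σ : ℝ≥0) (m : Measure ℝ) : absWeightLaw σ m (Iio 0) = 0 := by
  rw [absWeightLaw, Measure.map_apply (by fun_prop) measurableSet_Iio]
  convert measure_empty (μ := m.prod (gaussianReal 0 (σ ^ 2)))
  ext q; simpa using by positivity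

section Gaussian

variable {σ : ℝ≥0}

theorem ae_gaussianReal_ne_zero (hσ : 0 < σ) : ∀ᵐ v ∂(gaussianReal 0 (σ ^ 2)), v ≠ 0 := by
  have := nullSingletonClass_gaussianReal (μ := 0) (pow_pos hσ 2).ne'
  rw [ae_iff]; simp

theorem measureReal_absWeightLaw_Ioi (hσ : 0 < σ) (m : Measure ℝ) [IsProbabilityMeasure m] {x : ℝ}
    (hx : 0 < x) : (absWeightLaw σ m).real (Ioi x) =
      ∫ v, levyTail m (x ^ 2 / v ^ 2) ∂(gaussianReal 0 (σ ^ 2)) := by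
  have hmeas : Measurable fun q : ℝ × ℝ => |√q.1 * q.2| := by fun_prop
  rw [absWeightLaw, map_measureReal_apply hmeas measurableSet_Ioi]
  refine measureReal_prod_eq_integral_levyTail (hmeas measurableSet_Ioi) ?_
    (Eventually.of_forall fun v => measure_lt_top _ _)
  filter_upwards [ae_gaussianReal_ne_zero hσ] with v hv
  ext w
  simp only [mem_preimage, mem_Ioi]
  exact lt_abs_sqrt_mul_iff hx hv w

/-- Each bad level comes from at most two values of `v`, and a nondegenerate Gaussian does not
charge countable sets. This is why the weights need no exceptional levels `x`. -/
theorem ae_gaussianReal_sq_div_sq_notMem (hσ : 0 < σ) {C : Set ℝ} (hC : C.Countable) {x : ℝ}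
    (hx : 0 < x) :
    ∀ᵐ v ∂(gaussianReal 0 (σ ^ 2)), x ^ 2 / v ^ 2 ∉ C := by
  have := nullSingletonClass_gaussianReal (μ := 0) (pow_pos hσ 2).ne'
  filter_upwards [ae_gaussianReal_ne_zero hσ, (show (⋃ y ∈ C, {v : ℝ | v = √(x ^ 2 / y) ∨
    v = -√(x ^ 2 / y)}).Countable from hC.biUnion fun y _ =>
      (Set.toFinite {√(x ^ 2 / y), -√(x ^ 2 / y)}).countable).ae_notMem _] with v hv hv2 hmem
  refine hv2 (mem_iUnion₂.2 ⟨_, hmem, ?_⟩)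
  have e : x ^ 2 / (x ^ 2 / v ^ 2) = v ^ 2 := by field_simp
  simp only [e, Real.sqrt_sq_eq_abs, mem_ofPred_eq]
  rcases abs_choice v with h | h <;> rw [h] <;> simp

/-- Dominated convergence in `v`: at level `x² / v²` the bound `B (1 + y⁻¹)` reads `B (1 + v² /
x²)`, integrable by the Gaussian second moment. -/
theorem tendsto_mul_measureReal_absWeightLaw_Ioi {ι : Type*} {F : Filter ι}
    [F.IsCountablyGenerated] {N : ι → ℕ} {η : ι → Measure ℝ} [∀ i, IsProbabilityMeasure (η i)]
    {ρ : Measure ℝ} (hσ : 0 < σ) {C : Set ℝ} (hC : C.Countable)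
    (hconv : ∀ y, 0 < y → y ∉ C →
      Tendsto (fun i => (N i : ℝ) * (η i).real (Ioi y)) F (𝓝 (levyTail ρ y)))
    {B : ℝ} (hB : ∀ᶠ i in F, ∀ y, 0 < y → (N i : ℝ) * (η i).real (Ioi y) ≤ B * (1 + y⁻¹))
    {x : ℝ} (hx : 0 < x) :
    Tendsto (fun i => (N i : ℝ) * (absWeightLaw σ (η i)).real (Ioi x)) F
      (𝓝 (∫ v, levyTail ρ (x ^ 2 / v ^ 2) ∂(gaussianReal 0 (σ ^ 2)))) := by
  simp only [measureReal_absWeightLaw_Ioi hσ _ hx, ← integral_const_mul]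
  refine tendsto_integral_filter_of_dominated_convergence
    (fun v => B * (1 + (x ^ 2)⁻¹ * v ^ 2)) ?_ ?_ ?_ ?_
  · exact Eventually.of_forall fun i => (((measurable_levyTail _).comp
      (by fun_prop : Measurable fun v : ℝ => x ^ 2 / v ^ 2)).const_mul _).aestronglyMeasurable
  · filter_upwards [hB] with i hi
    filter_upwards [ae_gaussianReal_ne_zero hσ] with v hv
    rw [Real.norm_of_nonneg (mul_nonneg (Nat.cast_nonneg _) (levyTail_nonneg _ _))]
    refine (hi _ (by positivity)).trans_eq ?_
    rw [inv_div, div_eq_inv_mul]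
  · exact ((integrable_const _).add
      ((memLp_id_gaussianReal 2).integrable_sq.const_mul _)).const_mul _
  · filter_upwards [ae_gaussianReal_ne_zero hσ, ae_gaussianReal_sq_div_sq_notMem hσ hC hx]
      with v hv hvC
    exact hconv _ (by positivity) hvC

end Gaussian

/-! ### The Gamma mixture of a Lévy measure and its power law. -/

section GammaMixture

variable {ρ : Measure ℝ}

theorem levyTail_le (hρ : IsLevyMeasure ρ) {y : ℝ} (hy : 0 < y) :
    levyTail ρ y ≤ (∫ w, (1 - Real.exp (-w)) ∂ρ) * (1 + y⁻¹) :=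
  measureReal_Ioi_le_of_integrable (hρ.ae_pos.mono fun _ h => h.le) hρ.integrable_one_sub_exp hy

theorem ae_preimage_mul_eq_Ioi (z : ℝ) : ∀ᵐ g ∂(gammaMeasure (1 / 2) (1 / 2)),
    (fun w => (w, g)) ⁻¹' ((fun q : ℝ × ℝ => q.1 * q.2) ⁻¹' Ioi z) = Ioi (z / g) := by
  filter_upwards [ae_pos_gammaMeasure] with g hg
  ext w
  simp [div_lt_iff₀ hg]

theorem ae_measure_Ioi_div_lt_top (hρ : IsLevyMeasure ρ) {z : ℝ} (hz : 0 < z) :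
    ∀ᵐ g ∂(gammaMeasure (1 / 2) (1 / 2)), ρ (Ioi (z / g)) < ∞ := by
  filter_upwards [ae_pos_gammaMeasure] with g hg
  exact (hρ.measure_Ioi_ne_top _ (div_pos hz hg)).lt_top

theorem levyTail_gammaMixture (hρ : IsLevyMeasure ρ) {z : ℝ} (hz : 0 < z) :
    levyTail (gammaMixture ρ) z = ∫ g, levyTail ρ (z / g) ∂(gammaMeasure (1 / 2) (1 / 2)) := by
  have := hρ.sigmaFinite
  have := isProbabilityMeasure_gammaMeasure (a := 1 / 2) (r := 1 / 2) (by norm_num) (by norm_num)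
  have hmeas : Measurable fun q : ℝ × ℝ => q.1 * q.2 := by fun_prop
  rw [levyTail, gammaMixture, map_measureReal_apply hmeas measurableSet_Ioi]
  exact measureReal_prod_eq_integral_levyTail (hmeas measurableSet_Ioi)
    (ae_preimage_mul_eq_Ioi z) (ae_measure_Ioi_div_lt_top hρ hz)

theorem gammaMixture_Ioi_lt_top (hρ : IsLevyMeasure ρ) {z : ℝ} (hz : 0 < z) :
    gammaMixture ρ (Ioi z) < ∞ := by
  have := hρ.sigmaFinite
  have := isProbabilityMeasure_gammaMeasure (a := 1 / 2) (r := 1 / 2) (by norm_num) (by norm_num)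
  have hmeas : Measurable fun q : ℝ × ℝ => q.1 * q.2 := by fun_prop
  rw [gammaMixture, Measure.map_apply hmeas measurableSet_Ioi]
  refine measure_prod_lt_top_of_integrable_levyTail (hmeas measurableSet_Ioi)
    (ae_preimage_mul_eq_Ioi z) (ae_measure_Ioi_div_lt_top hρ hz) ?_
  have h1 : Integrable (fun g : ℝ => g) (gammaMeasure (1 / 2) (1 / 2)) := by
    simpa using integrable_rpow_gammaMeasure_half zero_le_one
  refine Integrable.mono' (((integrable_const (1 : ℝ)).add (h1.const_mul z⁻¹)).const_mul
    (∫ w, (1 - Real.exp (-w)) ∂ρ)) ((measurable_levyTail _).comp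
      (by fun_prop : Measurable fun g : ℝ => z / g)).aestronglyMeasurable ?_
  filter_upwards [ae_pos_gammaMeasure] with g hg
  rw [Real.norm_of_nonneg (levyTail_nonneg _ _)]
  refine (levyTail_le hρ (div_pos hz hg)).trans_eq ?_
  simp only [Pi.add_apply, inv_div, ← div_eq_inv_mul]

theorem integral_levyTail_gaussianReal (hρ : IsLevyMeasure ρ) {σ : ℝ≥0} (hσ : 0 < σ) {x : ℝ}
    (hx : 0 < x) : ∫ v, levyTail ρ (x ^ 2 / v ^ 2) ∂(gaussianReal 0 (σ ^ 2)) =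
      levyTail (gammaMixture ρ) (x ^ 2 / (σ : ℝ) ^ 2) := by
  have hσ' : (0 : ℝ) < σ := hσ
  have h1 : (gaussianReal 0 (σ ^ 2)).map (fun v => v / (σ : ℝ)) = gaussianReal 0 1 := by
    rw [gaussianReal_map_div_const]
    congr 1
    · simp
    · rw [← NNReal.coe_inj]; push_cast
      simp [hσ'.ne']
  have hm : ∀ z : ℝ, AEStronglyMeasurable (fun g => levyTail ρ (z / g))
      (gammaMeasure (1 / 2) (1 / 2)) := fun z =>
    ((measurable_levyTail _).comp (by fun_prop : Measurable fun g : ℝ => z / g)).aestronglyMeasurable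
  have hm2 : ∀ z : ℝ, Measurable (fun v => levyTail ρ (z / v ^ 2)) := fun z =>
    (measurable_levyTail _).comp (by fun_prop)
  rw [levyTail_gammaMixture hρ (by positivity), ← gaussianReal_map_sq, integral_map (by fun_prop)
    (gaussianReal_map_sq ▸ hm _), ← h1, integral_map (by fun_prop) (hm2 _).aestronglyMeasurable]
  refine integral_congr_ae (Eventually.of_forall fun v => ?_)
  simp only
  congr 1
  rw [div_pow, div_div_div_cancel_right₀ (by positivity)]

variable {τ c : ℝ}

theorem tendsto_rpow_mul_levyTail
    (h : Asymptotics.IsEquivalent atTop (levyTail ρ) (fun x => c * x ^ (-τ))) :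
    Tendsto (fun u => u ^ τ * levyTail ρ u) atTop (𝓝 c) := by
  have h1 := (Asymptotics.IsEquivalent.refl (u := fun u : ℝ => u ^ τ) (l := atTop)).mul h
  refine h1.symm.tendsto_nhds (tendsto_const_nhds.congr' ?_)
  filter_upwards [eventually_gt_atTop 0] with u hu
  simp only [Pi.mul_apply]
  rw [mul_left_comm, ← Real.rpow_add hu]; simp

/-- A bound valid for all `u`, needed because `y / g` is small when `g` is large: the limit controls
large `u`, and the bound of the tail by `1 + u⁻¹` controls the rest. -/
theorem exists_rpow_mul_levyTail_le (hρ : IsLevyMeasure ρ) (hτ : 0 < τ)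
    (h : Tendsto (fun u => u ^ τ * levyTail ρ u) atTop (𝓝 c)) :
    ∃ K, 0 ≤ K ∧ ∀ u, 0 < u → u ^ τ * levyTail ρ u ≤ K * (1 + u⁻¹) := by
  obtain ⟨u₀, hu₀⟩ := eventually_atTop.1 (h.eventually_le_const (lt_add_one c))
  set K₀ := ∫ w, (1 - Real.exp (-w)) ∂ρ with hK₀
  have hK0 : 0 ≤ K₀ := integral_nonneg_of_ae <| by
    filter_upwards [hρ.ae_pos] with w hw using one_sub_exp_neg_nonneg hw.le
  refine ⟨max (c + 1) (|u₀| ^ τ * K₀), le_max_of_le_right (by positivity), fun u hu => ?_⟩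
  rcases le_total u₀ u with h1 | h1
  · have h2 := hu₀ u h1
    have h3 : 0 ≤ c + 1 := le_trans (mul_nonneg (by positivity) (levyTail_nonneg _ _)) h2
    calc u ^ τ * levyTail ρ u ≤ (c + 1) * 1 := by linarith
      _ ≤ _ := by
        refine mul_le_mul (le_max_left _ _) ?_ zero_le_one (h3.trans (le_max_left _ _))
        have : 0 < u⁻¹ := by positivity
        linarith
  · calc u ^ τ * levyTail ρ u ≤ |u₀| ^ τ * (K₀ * (1 + u⁻¹)) := by
          refine mul_le_mul (Real.rpow_le_rpow hu.le (h1.trans (le_abs_self _)) hτ.le)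
            (levyTail_le hρ hu) (levyTail_nonneg _ _) (by positivity)
      _ ≤ _ := by
        rw [← mul_assoc]
        exact mul_le_mul_of_nonneg_right (le_max_right _ _) (by positivity)

/-- Breiman's argument: for fixed `g`, writing `y ^ τ = g ^ τ (y / g) ^ τ` shows that the integrand
tends to `c g ^ τ`. For `y ≥ 1` it is dominated by a multiple of `g ^ τ + g ^ (τ + 1)`, and all
moments of the Gamma law are finite. -/
theorem tendsto_rpow_mul_levyTail_gammaMixture (hρ : IsLevyMeasure ρ) (hτ : 0 < τ)
    (h : Tendsto (fun u => u ^ τ * levyTail ρ u) atTop (𝓝 c)) :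
    Tendsto (fun y => y ^ τ * levyTail (gammaMixture ρ) y) atTop
      (𝓝 (2 ^ τ * Real.Gamma (τ + 1 / 2) / √Real.pi * c)) := by
  obtain ⟨K, hK0, hK⟩ := exists_rpow_mul_levyTail_le hρ hτ h
  have hsplit : ∀ y g : ℝ, 0 < y → 0 < g →
      y ^ τ * levyTail ρ (y / g) = g ^ τ * ((y / g) ^ τ * levyTail ρ (y / g)) := by
    intro y g hy hg
    rw [← mul_assoc, ← Real.mul_rpow hg.le (by positivity), mul_div_cancel₀ _ hg.ne']
  have h1 : Tendsto (fun y => ∫ g, y ^ τ * levyTail ρ (y / g) ∂(gammaMeasure (1 / 2) (1 / 2)))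
      atTop (𝓝 (∫ g, g ^ τ * c ∂(gammaMeasure (1 / 2) (1 / 2)))) := by
    refine tendsto_integral_filter_of_dominated_convergence
      (fun g => K * (g ^ τ + g ^ (τ + 1))) ?_ ?_ ?_ ?_
    · exact Eventually.of_forall fun y => (((measurable_levyTail _).comp
        (by fun_prop : Measurable fun g : ℝ => y / g)).const_mul _).aestronglyMeasurable
    · filter_upwards [eventually_ge_atTop 1] with y hy
      filter_upwards [ae_pos_gammaMeasure] with g hg
      have hy0 : 0 < y := by linarith
      rw [Real.norm_of_nonneg (mul_nonneg (by positivity) (levyTail_nonneg _ _)), hsplit y g hy0 hg]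
      calc g ^ τ * ((y / g) ^ τ * levyTail ρ (y / g)) ≤ g ^ τ * (K * (1 + g)) := by
            refine mul_le_mul_of_nonneg_left ((hK _ (by positivity)).trans
              (mul_le_mul_of_nonneg_left ?_ hK0)) (by positivity)
            rw [inv_div]
            linarith [div_le_self hg.le hy]
        _ = K * (g ^ τ + g ^ (τ + 1)) := by rw [Real.rpow_add_one hg.ne']; ring
    · exact ((integrable_rpow_gammaMeasure_half hτ.le).add
        (integrable_rpow_gammaMeasure_half (by linarith))).const_mul K
    · filter_upwards [ae_pos_gammaMeasure] with g hg
      have h2 : Tendsto (fun y => g ^ τ * ((y / g) ^ τ * levyTail ρ (y / g))) atTop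
          (𝓝 (g ^ τ * c)) :=
        (h.comp (tendsto_id.atTop_div_const hg)).const_mul _
      refine h2.congr' ?_
      filter_upwards [eventually_gt_atTop 0] with y hy using (hsplit y g hy hg).symm
  rw [integral_mul_const, integral_rpow_gammaMeasure_half hτ.le] at h1
  refine h1.congr' ?_
  filter_upwards [eventually_gt_atTop 0] with y hy
  rw [levyTail_gammaMixture hρ hy, integral_const_mul]

end GammaMixture

/-! ### Joint laws within one layer of the network. -/

/-- The joint law of the two independent families is a product over `Fin n ⊕ Fin n`; regrouping it
into pairs gives i.i.d. pairs, to which `f` applies coordinatewise. -/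
theorem hasLaw_pi_map_prod {Ω : Type*} [MeasurableSpace Ω] {P : Measure Ω} {n : ℕ}
    {X Z : Fin n → Ω → ℝ} {m κ : Measure ℝ} [IsProbabilityMeasure m] [IsProbabilityMeasure κ]
    (hX : ∀ j, HasLaw (X j) m P) (hZ : ∀ j, HasLaw (Z j) κ P) (h : iIndepFun (Sum.elim X Z) P)
    {f : ℝ × ℝ → ℝ} (hf : Measurable f) :
    HasLaw (fun ω j => f (X j ω, Z j ω)) (Measure.pi fun _ => (m.prod κ).map f) P := by
  have hm : ∀ s : Fin n ⊕ Fin n,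
      IsProbabilityMeasure ((Sum.elim (fun _ => m) (fun _ => κ) : Fin n ⊕ Fin n → Measure ℝ) s) := by
    rintro (j | j) <;> simpa
  have h1 : HasLaw (fun ω s => Sum.elim X Z s ω)
      (Measure.pi (Sum.elim (fun _ => m) (fun _ => κ))) P := by
    refine iIndepFun.hasLaw_pi ?_ h
    rintro (j | j)
    exacts [hX j, hZ j]
  have h2 := measurePreserving_sumPiEquivProdPi (X := fun _ : Fin n ⊕ Fin n => ℝ)
    (Sum.elim (fun _ => m) (fun _ => κ))
  have h3 := (measurePreserving_arrowProdEquivProdArrow ℝ ℝ (Fin n) (fun _ => m) (fun _ => κ)).symm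
  have : IsProbabilityMeasure ((m.prod κ).map f) := Measure.isProbabilityMeasure_map hf.aemeasurable
  have h4 : MeasurePreserving (fun (x : Fin n → ℝ × ℝ) j => f (x j))
      (Measure.pi fun _ => m.prod κ) (Measure.pi fun _ => (m.prod κ).map f) :=
    ⟨by fun_prop, Measure.pi_map_pi fun _ => hf.aemeasurable⟩
  exact (h4.hasLaw.comp (h3.hasLaw.comp h2.hasLaw)).comp h1

theorem IsWeightModel.hasLaw_lam {L : ℕ} {din dout : ℕ+} {μ : Fin L → ℕ+ → Measure ℝ} {σ : ℝ≥0}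
    {p : Fin L → ℕ+} {Ω : Type*} [MeasurableSpace Ω] {P : Measure Ω}
    {lam : (i : Fin (L + 1)) → Fin (layerWidth din dout p i.castSucc) → Ω → ℝ}
    {V : (i : Fin (L + 1)) → Fin (layerWidth din dout p i.castSucc) →
      Fin (layerWidth din dout p i.succ) → Ω → ℝ}
    (h : IsWeightModel din dout μ σ p P lam V) (l : Fin L) :
    HasLaw (fun ω j => lam l.succ j ω) (Measure.pi fun _ => μ l (p l)) P :=
  iIndepFun.hasLaw_pi (fun j => h.lam_law l j) <|
    h.indep.precomp (g := fun j => Sum.inl ⟨l.succ, j⟩) fun i j hij => by simpa using hij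

theorem IsWeightModel.hasLaw_abs_weight {L : ℕ} {din dout : ℕ+} {μ : Fin L → ℕ+ → Measure ℝ}
    {σ : ℝ≥0} {p : Fin L → ℕ+} {Ω : Type*} [MeasurableSpace Ω] {P : Measure Ω}
    {lam : (i : Fin (L + 1)) → Fin (layerWidth din dout p i.castSucc) → Ω → ℝ}
    {V : (i : Fin (L + 1)) → Fin (layerWidth din dout p i.castSucc) →
      Fin (layerWidth din dout p i.succ) → Ω → ℝ}
    (h : IsWeightModel din dout μ σ p P lam V) (l : Fin L) [IsProbabilityMeasure (μ l (p l))]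
    (m : Fin (layerWidth din dout p l.succ.succ)) :
    HasLaw (fun ω j => |weight lam V l.succ j m ω|)
      (Measure.pi fun _ => absWeightLaw σ (μ l (p l))) P := by
  refine hasLaw_pi_map_prod (X := fun j => lam l.succ j) (Z := fun j => V l.succ j m)
    (fun j => h.lam_law l j) (fun j => h.V_law l.succ j m) ?_
    (f := fun q => |√q.1 * q.2|) (by fun_prop)
  have h1 := h.indep.precomp
    (g := Sum.map (fun j => ⟨l.succ, j⟩) (fun j => ⟨l.succ, (j, m)⟩))
    (Sum.map_injective.2 ⟨fun i j hij => by simpa using hij, fun i j hij => by simpa using hij⟩)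
  convert h1 with s
  rcases s with j | j <;> rfl

/-! ### Asymptotics of the limit tails and conclusion. -/

theorem isEquivalent_pow_div_factorial {T : ℝ → ℝ} {C e : ℝ}
    (h : Asymptotics.IsEquivalent atTop T (fun x => C * x ^ (-e))) (k : ℕ) :
    Asymptotics.IsEquivalent atTop (fun x => T x ^ k / (k.factorial : ℝ))
      (fun x => C ^ k / (k.factorial : ℝ) * x ^ (-((k : ℝ) * e))) := by
  refine ((h.pow k).div (Asymptotics.IsEquivalent.refl
    (u := fun _ => (k.factorial : ℝ)))).congr_right ?_
  filter_upwards [eventually_gt_atTop 0] with x hx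
  simp only [Pi.div_apply, Pi.pow_apply]
  rw [mul_pow, ← Real.rpow_mul_natCast hx.le, show -e * (k : ℝ) = -((k : ℝ) * e) by ring]
  ring

theorem isEquivalent_levyTail_gammaMixture {ρ : Measure ℝ} {τ c : ℝ} (hρ : IsLevyMeasure ρ)
    (hτ : 0 < τ) (hc : 0 < c)
    (h : Asymptotics.IsEquivalent atTop (levyTail ρ) (fun x => c * x ^ (-τ))) {σ : ℝ≥0}
    (hσ : 0 < σ) :
    Asymptotics.IsEquivalent atTop (fun x => levyTail (gammaMixture ρ) (x ^ 2 / (σ : ℝ) ^ 2))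
      (fun x => 2 ^ τ * Real.Gamma (τ + 1 / 2) / √Real.pi * ((σ : ℝ) ^ 2) ^ τ * c *
        x ^ (-(2 * τ))) := by
  have hσ' : (0 : ℝ) < σ := hσ
  have hG := Real.Gamma_pos_of_pos (s := τ + 1 / 2) (by positivity)
  have h1 := tendsto_rpow_mul_levyTail_gammaMixture hρ hτ (tendsto_rpow_mul_levyTail h)
  have h2 := (Asymptotics.isEquivalent_const_iff_tendsto (by positivity)).2 h1
  have hlim : Tendsto (fun x : ℝ => x ^ 2 / (σ : ℝ) ^ 2) atTop atTop :=
    (tendsto_pow_atTop two_ne_zero).atTop_div_const (by positivity)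
  have h3 := (h2.mul (Asymptotics.IsEquivalent.refl (u := fun y : ℝ => y ^ (-τ)))).comp_tendsto hlim
  refine (h3.congr_left ?_).congr_right ?_
  · filter_upwards [eventually_gt_atTop 0] with x hx
    have : 0 < x ^ 2 / (σ : ℝ) ^ 2 := by positivity
    simp only [Function.comp, Pi.mul_apply]
    rw [mul_right_comm, ← Real.rpow_add this]; simp
  · filter_upwards [eventually_gt_atTop 0] with x hx
    simp only [Function.comp, Pi.mul_apply, Function.const_apply]
    have e1 : (x ^ 2) ^ τ = x ^ (2 * τ) := by
      rw [← Real.rpow_natCast, ← Real.rpow_mul hx.le]; norm_num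
    rw [Real.rpow_neg (by positivity), Real.div_rpow (by positivity) (by positivity), e1, inv_div,
      Real.rpow_neg hx.le]
    ring

theorem isEquivalent_of_eq_poissonTail {T q : ℝ → ℝ} (hT : Tendsto T atTop (𝓝 0)) {k : ℕ}
    (hq : ∀ x, 0 < x → q x = poissonTail k (T x)) :
    Asymptotics.IsEquivalent atTop q (fun x => T x ^ k / (k.factorial : ℝ)) := by
  refine ((poissonTail_isEquivalent k).comp_tendsto hT).congr_left ?_
  filter_upwards [eventually_gt_atTop 0] with x hx using (hq x hx).symm

/-- The image of `gammaMixture ρ` under `z ↦ σ √z`. -/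
theorem map_gammaMixture_Ioi (ρ : Measure ℝ) {σ : ℝ≥0} (hσ : 0 < σ) {x : ℝ} (hx : 0 < x) :
    (gammaMixture ρ).map (fun z => (σ : ℝ) * √z) (Ioi x) =
      gammaMixture ρ (Ioi (x ^ 2 / (σ : ℝ) ^ 2)) := by
  have hσ' : (0 : ℝ) < σ := hσ
  rw [Measure.map_apply (by fun_prop) measurableSet_Ioi]
  congr 1
  ext z
  simp only [mem_preimage, mem_Ioi]
  rw [← div_pow, ← Real.lt_sqrt (by positivity), div_lt_iff₀' hσ']

theorem mainTheorem6 {L : ℕ} (din dout : ℕ+)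
    -- laws of the node variances, by hidden layer and width, carried by `[0, ∞)`
    (μ : Fin L → ℕ+ → Measure ℝ) [∀ l n, IsProbabilityMeasure (μ l n)]
    (hμ : ∀ l n, μ l n (Iio 0) = 0)
    (σ : ℝ≥0) (hσ : 0 < σ)
    -- one random network for each vector `p` of hidden widths
    {Ω : (Fin L → ℕ+) → Type*} [∀ p, MeasurableSpace (Ω p)]
    (P : (p : Fin L → ℕ+) → Measure (Ω p)) [∀ p, IsProbabilityMeasure (P p)]
    (lam : (p : Fin L → ℕ+) → (i : Fin (L + 1)) →
      Fin (layerWidth din dout p i.castSucc) → Ω p → ℝ)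
    (V : (p : Fin L → ℕ+) → (i : Fin (L + 1)) → Fin (layerWidth din dout p i.castSucc) →
      Fin (layerWidth din dout p i.succ) → Ω p → ℝ)
    (hmodel : ∀ p, IsWeightModel din dout μ σ p (P p) (lam p) (V p))
    -- a hidden layer whose sum of variances converges in distribution to `ID(a, ρ)`
    (l : Fin L) (a : ℝ) (ρ Λ : Measure ℝ) [IsProbabilityMeasure Λ] (hΛ : IsID a ρ Λ)
    (hsum : TendstoInDistribution (fun p ω => ∑ j, lam p l.succ j ω)
      (comap (fun p : Fin L → ℕ+ => p l) atTop) id P Λ)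
    -- the power-law assumption
    (τ c : ℝ) (hτ : 0 < τ) (hc : 0 < c)
    (hρ : Asymptotics.IsEquivalent atTop (levyTail ρ) (fun x => c * x ^ (-τ)))
    -- a rank `k`, and a node of the next layer for each network
    (k : ℕ) (hk : 1 ≤ k) (m : (p : Fin L → ℕ+) → Fin (layerWidth din dout p l.succ.succ)) :
    (∃ (Q : Measure ℝ) (_ : IsProbabilityMeasure Q),
      TendstoInDistribution (fun p ω => kthLargest (fun j => lam p l.succ j ω) k)
        (comap (fun p : Fin L → ℕ+ => p l) atTop) id P Q ∧
      (∀ x : ℝ, 0 < x → ρ {x} = 0 →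
        Tendsto (fun p => (P p).real {ω | x < kthLargest (fun j => lam p l.succ j ω) k})
          (comap (fun p : Fin L → ℕ+ => p l) atTop) (𝓝 (Q.real (Ioi x)))) ∧
      Asymptotics.IsEquivalent atTop (fun x => Q.real (Ioi x))
        (fun x => levyTail ρ x ^ k / (k.factorial : ℝ)) ∧
      Asymptotics.IsEquivalent atTop (fun x => levyTail ρ x ^ k / (k.factorial : ℝ))
        (fun x => c ^ k / (k.factorial : ℝ) * x ^ (-((k : ℝ) * τ)))) ∧
    (∃ (Q : Measure ℝ) (_ : IsProbabilityMeasure Q),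
      TendstoInDistribution
        (fun p ω => kthLargest (fun j => |weight (lam p) (V p) l.succ j (m p) ω|) k)
        (comap (fun p : Fin L → ℕ+ => p l) atTop) id P Q ∧
      (∀ x : ℝ, 0 < x →
        Tendsto
          (fun p => (P p).real
            {ω | x < kthLargest (fun j => |weight (lam p) (V p) l.succ j (m p) ω|) k})
          (comap (fun p : Fin L → ℕ+ => p l) atTop) (𝓝 (Q.real (Ioi x)))) ∧
      Asymptotics.IsEquivalent atTop (fun x => Q.real (Ioi x))
        (fun x => levyTail (gammaMixture ρ) (x ^ 2 / (σ : ℝ) ^ 2) ^ k / (k.factorial : ℝ)) ∧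
      Asymptotics.IsEquivalent atTop
        (fun x => levyTail (gammaMixture ρ) (x ^ 2 / (σ : ℝ) ^ 2) ^ k / (k.factorial : ℝ))
        (fun x => (2 ^ τ * Real.Gamma (τ + 1 / 2) / √Real.pi * ((σ : ℝ) ^ 2) ^ τ * c) ^ k /
          (k.factorial : ℝ) * x ^ (-(2 * (k : ℝ) * τ)))) := by
  set F : Filter (Fin L → ℕ+) := comap (fun p : Fin L → ℕ+ => p l) atTop with hF
  have hρL : IsLevyMeasure ρ := hΛ.levy
  have hN : Tendsto (fun p : Fin L → ℕ+ => ((layerWidth din dout p l.succ.castSucc : ℕ+) : ℕ)) F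
      atTop := by
    simp only [layerWidth_hidden]
    exact tendsto_PNat_val_atTop_atTop.comp tendsto_comap
  have hη : ∀ p : Fin L → ℕ+, ∀ᵐ w ∂(μ l (p l)), 0 ≤ w := fun p =>
    ae_nonneg_of_measure_Iio (hμ l (p l))
  have hlap := fun t ht => tendsto_laplace_exponent hN hη (fun p => (hmodel p).hasLaw_lam l) hΛ hsum
    (t := t) ht
  have hconv : ∀ x, 0 < x → x ∉ {x | ρ {x} ≠ 0} → Tendsto (fun p : Fin L → ℕ+ =>
      ((layerWidth din dout p l.succ.castSucc : ℕ) : ℝ) * (μ l (p l)).real (Ioi x)) F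
      (𝓝 (levyTail ρ x)) := fun x hx hx0 =>
    tendsto_mul_measureReal_Ioi hη hρL hlap hx (by simpa using hx0)
  refine ⟨?_, ?_⟩
  · obtain ⟨Q, hQ, hdist, htail, hQt⟩ := exists_limit_law_kthLargest P hN
      (fun p => μ l (p l)) (fun p => hμ l (p l)) (fun p j => lam p l.succ j)
      (fun p => (hmodel p).hasLaw_lam l) hρL.measure_Ioi_ne_top hρL.countable_atoms hconv hk
    exact ⟨Q, hQ, hdist, fun x hx hx0 => htail x hx (by simpa using hx0),
      isEquivalent_of_eq_poissonTail
        (tendsto_levyTail_atTop (hρL.measure_Ioi_ne_top 1 one_pos)) hQt,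
      isEquivalent_pow_div_factorial hρ k⟩
  · obtain ⟨B, hB⟩ := eventually_mul_measureReal_Ioi_le hη hlap
    have hσ' : (0 : ℝ) < σ := hσ
    -- The limiting intensity for the weights is the image of the mixture under `z ↦ σ √z`, so that
    -- its tail at `x` is the mixture tail at `x² / σ²` and the general limit law applies with no
    -- exceptional levels.
    have hM : ∀ x, 0 < x → (gammaMixture ρ).map (fun z => (σ : ℝ) * √z) (Ioi x) ≠ ∞ := by
      intro x hx
      rw [map_gammaMixture_Ioi ρ hσ hx]
      exact (gammaMixture_Ioi_lt_top hρL (by positivity)).ne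
    have hMt : ∀ x, 0 < x → levyTail ((gammaMixture ρ).map (fun z => (σ : ℝ) * √z)) x =
        levyTail (gammaMixture ρ) (x ^ 2 / (σ : ℝ) ^ 2) := by
      intro x hx
      rw [levyTail, measureReal_def, map_gammaMixture_Ioi ρ hσ hx]
      rfl
    have := fun p : Fin L → ℕ+ => isProbabilityMeasure_absWeightLaw σ (μ l (p l))
    obtain ⟨Q, hQ, hdist, htail, hQt⟩ := exists_limit_law_kthLargest P hN
      (fun p => absWeightLaw σ (μ l (p l))) (fun p => absWeightLaw_Iio_zero σ _)
      (fun p j ω => |weight (lam p) (V p) l.succ j (m p) ω|)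
      (fun p => (hmodel p).hasLaw_abs_weight l (m p)) hM countable_empty
      (fun x hx _ => by
        rw [hMt x hx, ← integral_levyTail_gaussianReal hρL hσ hx]
        exact tendsto_mul_measureReal_absWeightLaw_Ioi hσ hρL.countable_atoms hconv hB hx) hk
    have hequiv := isEquivalent_levyTail_gammaMixture hρL hτ hc hρ hσ
    have hlim0 : Tendsto (fun x => levyTail (gammaMixture ρ) (x ^ 2 / (σ : ℝ) ^ 2)) atTop (𝓝 0) :=
      (tendsto_levyTail_atTop (gammaMixture_Ioi_lt_top hρL one_pos).ne).comp
        ((tendsto_pow_atTop two_ne_zero).atTop_div_const (by positivity))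
    refine ⟨Q, hQ, hdist, fun x hx => htail x hx (notMem_empty x),
      isEquivalent_of_eq_poissonTail hlim0 fun x hx => by rw [hQt x hx, hMt x hx], ?_⟩
    have h := isEquivalent_pow_div_factorial hequiv k
    simpa only [show (k : ℝ) * (2 * τ) = 2 * (k : ℝ) * τ by ring] using h
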